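/- \textbf{Notation.} Let $n\ge 1$, $\langle n\rangle=\{1,\dots,n\}$, let $\theta$ be a permutation of $\langle n\rangle$, let $\gamma:\langle n\rangle\to\langle n\rangle$ be any map, let $k=c(\theta)$ be the number of cycles of $\theta$ (fixed points included), and let $\nu:\langle n\rangle\to\langle k\rangle$ be onto with $\nu\circ\theta=\nu$. Put $n_i=|\nu^{-1}(i)|$ for $i\in\langle k\rangle$. \emph{Weights.} A $k\times k$ co-ultrametric is a real symmetric matrix $A$ with $A(i,i)=1$, $A(i,j)\in[0,1]$ and $A(i,l)\ge\min(A(i,j),A(j,l))$ for all $i,j,l$. Its articulation is the number of distinct entries other than $0$ and $1$; its co-articulation is the number of classes of the equivalence relation $A(i,j)>0$; it is gapless if these two numbers sum to $k$. For a tree $\mathfrak T$ with vertex set $\langle k\rangle$ and edge set $E$, let $(x_e)_{e\in E}$ be i.i.d. uniform on $(0,1)$. Then $\mathrm{wt}_{\mathfrak T}$ is the random matrix that is, with probability one, the unique gapless co-ultrametric of articulation $|E|$ with $\mathrm{wt}_{\mathfrak T}(i,j)=x_{\{i,j\}}$ for every edge $\{i,j\}\in E$. It is a.s. positive definite; $\sqrt{\mathrm{wt}_{\mathfrak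 T}}$ denotes its positive square root. \emph{Splicing involutions.} $\mathrm{Splice}_{\mathfrak T}(\nu,\gamma)$ is the set of permutations $\tau$ of $\langle n\rangle$ with $\tau^2=1$ and $\gamma\circ\tau=\gamma$ that admit a factorization $\tau=(i_1\,j_1)\cdots(i_{k-1}\,j_{k-1})$ into disjoint transpositions such that the edge set of $\mathfrak T$ is $\{\{\nu(i_1),\nu(j_1)\},\dots,\{\nu(i_{k-1}),\nu(j_{k-1})\}\}$. \emph{Polynomials.} In the free algebra $\mathbb C\langle \mathbf X_1,\dots,\mathbf X_n\rangle$ put $$\mathrm{Poly}_{\theta,\gamma,\nu,\mathfrak T}=\sum_{\tau\in\mathrm{Splice}_{\mathfrak T}(\nu,\gamma)}\ \sum_{\substack{(i_1,\dots,i_n):\ i_1=1,\\ \theta\tau=(i_1\cdots i_n)}}\mathbf X_{i_1}^{\epsilon_\tau(i_1)}\cdots\mathbf X_{i_n}^{\epsilon_\tau(i_n)},\qquad \epsilon_\tau(i)=\begin{cases}1&\tau(i)=i,\\0&\tau(i)\ne i,\end{cases}$$ where the inner sum is over all $(i_1,\dots,i_n)\in\langle n\rangle^n$ with $i_1=1$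 such that the permutation $\theta\tau$ (first $\tau$, then $\theta$) is the $n$-cycle $(i_1\cdots i_n)$. With noncommuting variables $\mathbf Z(i,j)$, $(i,j)\in\langle k\rangle\times\langle n\rangle$, put $\mathbf Z_{\mathfrak T}(i,j)=\sum_{i'=1}^k\sqrt{\mathrm{wt}_{\mathfrak T}}(i,i')\,\mathbf Z(i',j)$ and $$\mathrm{Arb}_{\theta,\gamma,\nu}=\sum_{\mathfrak T}\mathbf E\Big(\mathrm{Poly}_{\theta,\gamma,\nu,\mathfrak T}\big|_{\mathbf X_i=\mathbf Z_{\mathfrak T}(\nu(i),\gamma(i)),\ i\in\langle n\rangle}\Big)\in\mathbb C\langle\{\mathbf Z(i,j)\}\rangle,$$ the sum being over all trees with vertex set $\langle k\rangle$ and the expectation being taken coefficient by coefficient after expansion into monomials in the $\mathbf Z(i,j)$. \textbf{Proposition.} Let $\mathcal A$ be a unital $C^*$-algebra with norm $\|\cdot\|$, let $\varphi$ be a faithful tracial state on $\mathcal A$, and let $\{\mathbf z(i,j)\}_{(i,j)\in\langle k\rangle\times\langle n\rangle}$ be a family in $\mathcal A$ of free (with respect to $\varphi$) standard semicircular variables,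 i.e. self-adjoint elements with $\varphi(\mathbf z(i,j)^m)=\frac1{2\pi}\int_{-2}^2t^m\sqrt{4-t^2}\,dt$ for all $m\ge0$. Then $$\Big\|\mathrm{Arb}_{\theta,\gamma,\nu}\big|_{\mathbf Z(i,j)=\mathbf z(i,j)}\Big\|\ \le\ \begin{cases}\displaystyle 2^{\,n-2k+2}\,\frac{(n-k)!\,\prod_{i=1}^kn_i}{(n-2k+2)!}&\text{if }n\ge 2k-2,\\[2mm] 0&\text{if }n<2k-2.\end{cases}$$ -/

import Mathlib

namespace PlanarMaps

/-! ### Co-ultrametrics and the random weight matrix of a tree -/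

section Weights

/-- A `k`-by-`k` co-ultrametric. -/
structure IsCoUltrametric {k : ℕ} (A : Matrix (Fin k) (Fin k) ℝ) : Prop where
  symm : ∀ i j, A i j = A j i
  diag : ∀ i, A i i = 1
  mem_Icc : ∀ i j, A i j ∈ Set.Icc (0 : ℝ) 1
  min_le : ∀ i j l, min (A i j) (A j l) ≤ A i l

/-- The number of distinct entries of `A` other than `0` and `1`. -/
noncomputable def articulation {k : ℕ} (A : Matrix (Fin k) (Fin k) ℝ) : ℕ :=
  (Set.range (fun p : Fin k × Fin k => A p.1 p.2) \ {0, 1}).ncard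

/-- The number of equivalence classes of the relation `A i j > 0`
(which is an equivalence relation when `A` is a co-ultrametric). -/
noncomputable def coarticulation {k : ℕ} (A : Matrix (Fin k) (Fin k) ℝ) : ℕ :=
  Nat.card (Quot fun i j : Fin k => 0 < A i j)

/-- A co-ultrametric is gapless if its articulation and co-articulation sum to `k`. -/
def IsGapless {k : ℕ} (A : Matrix (Fin k) (Fin k) ℝ) : Prop :=
  articulation A + coarticulation A = k

/-- `A` is a gapless co-ultrametric, of articulation the number of edges of `T`, whose entry
at each edge `e` of `T` is `x e`. -/
structure IsWeight {k : ℕ} (T : SimpleGraph (Fin k)) (x : T.edgeSet → ℝ)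
    (A : Matrix (Fin k) (Fin k) ℝ) : Prop where
  isCoUltrametric : IsCoUltrametric A
  apply_adj : ∀ i j (h : T.Adj i j), A i j = x ⟨s(i, j), h⟩
  isGapless : IsGapless A
  articulation_eq : articulation A = T.edgeSet.ncard

open Classical in
/-- The matrix `wt_T` as a function of the edge variables `x`: the unique matrix with the property
`IsWeight T x`. (For a tree `T` and distinct `x e` in `(0,1)`, an event of probability one, it
exists and is unique by `existsUnique_isWeight`; the value elsewhere is immaterial.) -/
noncomputable def weight {k : ℕ} (T : SimpleGraph (Fin k)) (x : T.edgeSet → ℝ) :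
    Matrix (Fin k) (Fin k) ℝ :=
  if h : ∃ A, IsWeight T x A then h.choose else 1

/-- The smallest of the numbers `1` and `x e`, for `e` an edge of the given walk. -/
def walkMin {k : ℕ} {T : SimpleGraph (Fin k)} (x : T.edgeSet → ℝ) :
    {i j : Fin k} → T.Walk i j → ℝ
  | _, _, .nil => 1
  | i, _, .cons (v := c) h p => min (x ⟨s(i, c), h⟩) (walkMin x p)

theorem le_walkMin_iff {k : ℕ} {T : SimpleGraph (Fin k)} (x : T.edgeSet → ℝ) {i j : Fin k}
    (p : T.Walk i j) (t : ℝ) :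
    t ≤ walkMin x p ↔ t ≤ 1 ∧ ∀ e : T.edgeSet, (e : Sym2 (Fin k)) ∈ p.edges → t ≤ x e := by
  induction p with
  | nil => simp [walkMin]
  | @cons a b c h p ih =>
    simp only [walkMin, le_min_iff, ih, SimpleGraph.Walk.edges_cons, List.mem_cons]
    constructor
    · rintro ⟨h1, h2, h3⟩
      refine ⟨h2, fun e he => ?_⟩
      rcases he with he | he
      · have : e = ⟨s(a, b), h⟩ := Subtype.ext he
        rw [this]; exact h1
      · exact h3 e he
    · rintro ⟨h1, h2⟩
      exact ⟨h2 _ (Or.inl rfl), h1, fun e he => h2 e (Or.inr he)⟩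

theorem walkMin_mem {k : ℕ} {T : SimpleGraph (Fin k)} (x : T.edgeSet → ℝ) {i j : Fin k}
    (p : T.Walk i j) :
    walkMin x p = 1 ∨ ∃ e : T.edgeSet, (e : Sym2 (Fin k)) ∈ p.edges ∧ walkMin x p = x e := by
  induction p with
  | nil => simp [walkMin]
  | @cons a b c h p ih =>
    simp only [walkMin, SimpleGraph.Walk.edges_cons, List.mem_cons]
    rcases min_choice (x ⟨s(a, b), h⟩) (walkMin x p) with h1 | h1
    · exact Or.inr ⟨⟨s(a, b), h⟩, Or.inl rfl, h1⟩
    · rw [h1]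
      rcases ih with ih | ⟨e, he, ih⟩
      · exact Or.inl ih
      · exact Or.inr ⟨e, Or.inr he, ih⟩

/-- Along any path the entries of a co-ultrametric are determined by those at the edges, provided
that the latter are distinct and less than `1`. -/
theorem IsCoUltrametric.eq_walkMin {k : ℕ} {T : SimpleGraph (Fin k)} {x : T.edgeSet → ℝ}
    (hinj : Function.Injective x) (hx : ∀ e, x e < 1) {A : Matrix (Fin k) (Fin k) ℝ}
    (hA : IsCoUltrametric A) (hadj : ∀ i j (h : T.Adj i j), A i j = x ⟨s(i, j), h⟩)
    {i j : Fin k} (p : T.Walk i j) (hp : p.IsTrail) : A i j = walkMin x p := by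
  induction p with
  | nil => simp [walkMin, hA.diag]
  | @cons a b c h p ih =>
    rw [SimpleGraph.Walk.isTrail_cons] at hp
    have ih := ih hp.1
    have hne : A a b ≠ A b c := by
      rw [hadj a b h, ih]
      rcases walkMin_mem x p with h1 | ⟨e, he, h1⟩
      · rw [h1]; exact (hx _).ne
      · rw [h1]
        intro h2
        have := hinj h2
        apply hp.2
        rw [← this] at he
        exact he
    simp only [walkMin]
    rw [← hadj a b h, ← ih]
    have h1 := hA.min_le a b c
    have h2 := hA.min_le b a c
    have h3 := hA.min_le a c b
    rw [hA.symm b a] at h2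
    rw [hA.symm c b] at h3
    rcases min_cases (A a b) (A b c) with g1 | g1 <;>
    rcases min_cases (A a b) (A a c) with g2 | g2 <;>
    rcases min_cases (A a c) (A b c) with g3 | g3 <;>
    first
      | linarith
      | (exfalso; apply hne; linarith)

/-- Existence and uniqueness of the weight matrix of a tree, with an explicit formula:
the `(i, j)` entry is the minimum of `x` over the edges of the path from `i` to `j`. -/
theorem existsUnique_isWeight {k : ℕ} {T : SimpleGraph (Fin k)} (hT : T.IsTree)
    {x : T.edgeSet → ℝ} (hinj : Function.Injective x) (hx : ∀ e, x e ∈ Set.Ioo (0 : ℝ) 1) :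
    ∃ A, IsWeight T x A ∧ (∀ B, IsWeight T x B → B = A) ∧
      ∀ i j (p : T.Walk i j), p.IsPath → A i j = walkMin x p := by
  choose P hP hPu using fun i j => hT.existsUnique_path i j
  have hk : Nonempty (Fin k) := hT.connected.nonempty
  set A : Matrix (Fin k) (Fin k) ℝ := fun i j => walkMin x (P i j) with hAdef
  have hle : ∀ i j (p : T.Walk i j), walkMin x p ≤ A i j := by
    intro i j p
    rw [hAdef]
    rw [le_walkMin_iff]
    have h1 := (le_walkMin_iff x p _).1 le_rfl
    refine ⟨h1.1, fun e he => h1.2 e ?_⟩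
    have : p.bypass = P i j := hPu i j _ (SimpleGraph.Walk.bypass_isPath p)
    rw [← this] at he
    exact SimpleGraph.Walk.edges_bypass_subset_edges p he
  have hpos : ∀ i j, 0 < A i j := by
    intro i j
    rcases walkMin_mem x (P i j) with h | ⟨e, -, h⟩
    · simp [hAdef, h]
    · rw [hAdef]; simp only [h]; exact (hx e).1
  have hpath : ∀ i j (p : T.Walk i j), p.IsPath → A i j = walkMin x p := by
    intro i j p hp
    rw [hAdef, hPu i j p hp]
  have hadj : ∀ i j (h : T.Adj i j), A i j = x ⟨s(i, j), h⟩ := by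
    intro i j h
    rw [hpath i j (.cons h .nil) (by simpa using h.ne)]
    simp only [walkMin]
    exact min_eq_left (hx _).2.le
  have hco : IsCoUltrametric A := by
    refine ⟨fun i j => ?_, fun i => ?_, fun i j => ⟨(hpos i j).le, ?_⟩, fun i j l => ?_⟩
    · have key : ∀ i j, A i j ≤ A j i := by
        intro i j
        refine le_trans ?_ (hle j i (P i j).reverse)
        rw [le_walkMin_iff]
        have h1 := (le_walkMin_iff x (P i j) _).1 le_rfl
        refine ⟨h1.1, fun e he => h1.2 e ?_⟩
        simpa using he
      exact le_antisymm (key i j) (key j i)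
    · rw [hpath i i .nil (by simp)]; simp [walkMin]
    · exact ((le_walkMin_iff x (P i j) _).1 le_rfl).1
    · refine le_trans ?_ (hle i l ((P i j).append (P j l)))
      rw [le_walkMin_iff]
      have h1 := (le_walkMin_iff x (P i j) _).1 le_rfl
      have h2 := (le_walkMin_iff x (P j l) _).1 le_rfl
      refine ⟨(min_le_left _ _).trans h1.1, fun e he => ?_⟩
      rw [SimpleGraph.Walk.edges_append, List.mem_append] at he
      rcases he with he | he
      · exact (min_le_left _ _).trans (h1.2 e he)
      · exact (min_le_right _ _).trans (h2.2 e he)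
  have hart : articulation A = T.edgeSet.ncard := by
    have hset : Set.range (fun p : Fin k × Fin k => A p.1 p.2) \ {0, 1} = Set.range x := by
      ext t
      constructor
      · rintro ⟨⟨⟨i, j⟩, rfl⟩, ht⟩
        rcases walkMin_mem x (P i j) with h | ⟨e, -, h⟩
        · exact absurd (Or.inr h) ht
        · exact ⟨e, h.symm⟩
      · rintro ⟨⟨e, he⟩, rfl⟩
        induction e using Sym2.ind with
        | _ i j =>
          refine ⟨⟨(i, j), hadj i j he⟩, ?_⟩
          rintro (h | h)
          · exact (hx ⟨s(i, j), he⟩).1.ne' h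
          · exact (hx ⟨s(i, j), he⟩).2.ne h
    rw [articulation, hset, ← Set.image_univ, Set.ncard_image_of_injective _ hinj,
      Set.ncard_univ]
    rfl
  have hcoart : coarticulation A = 1 := by
    rw [coarticulation, Nat.card_eq_one_iff_unique]
    refine ⟨⟨fun a b => ?_⟩, ⟨Quot.mk _ hk.some⟩⟩
    induction a using Quot.ind
    induction b using Quot.ind
    exact Quot.sound (hpos _ _)
  have hgap : IsGapless A := by
    rw [IsGapless, hart, hcoart]
    have := (SimpleGraph.isTree_iff_connected_and_card.1 hT).2
    rw [Nat.card_eq_fintype_card (α := Fin k), Fintype.card_fin] at this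
    exact this
  refine ⟨A, ⟨hco, hadj, hgap, hart⟩, fun B hB => ?_, hpath⟩
  ext i j
  exact hB.isCoUltrametric.eq_walkMin hinj (fun e => (hx e).2) hB.apply_adj _ (hP i j).isTrail

theorem isWeight_weight {k : ℕ} {T : SimpleGraph (Fin k)} (hT : T.IsTree)
    {x : T.edgeSet → ℝ} (hinj : Function.Injective x) (hx : ∀ e, x e ∈ Set.Ioo (0 : ℝ) 1) :
    IsWeight T x (weight T x) := by
  obtain ⟨A, hA, -⟩ := existsUnique_isWeight hT hinj hx
  have h : ∃ A, IsWeight T x A := ⟨A, hA⟩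
  rw [weight, dif_pos h]
  exact h.choose_spec

/-- The law of the i.i.d. family, uniform in `(0,1)`, indexed by the edges of `T`. -/
noncomputable def edgeLaw {k : ℕ} (T : SimpleGraph (Fin k)) :
    MeasureTheory.Measure (T.edgeSet → ℝ) :=
  haveI : Fintype T.edgeSet := Fintype.ofFinite _
  MeasureTheory.Measure.pi fun _ =>
    (MeasureTheory.volume : MeasureTheory.Measure ℝ).restrict (Set.Ioo 0 1)

open scoped MatrixOrder in
/-- The positive square root of the weight matrix. -/
noncomputable def sqrtWeight {k : ℕ} (T : SimpleGraph (Fin k)) (x : T.edgeSet → ℝ) :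
    Matrix (Fin k) (Fin k) ℝ :=
  CFC.sqrt (weight T x)

end Weights

/-! ### Splicing involutions and the arboreal polynomial -/

section Splicing

/-- The number of cycles, fixed points included, of a permutation. -/
noncomputable def numCycles {n : ℕ} (θ : Equiv.Perm (Fin n)) : ℕ :=
  Nat.card (Quotient (Equiv.Perm.SameCycle.setoid θ))

/-- `τ` is an involution which factors into `k - 1` disjoint transpositions `(i l, j l)` such that
the pairs `{ν (i l), ν (j l)}` are the edges of `T`. -/
def IsSplice {n k : ℕ} (T : SimpleGraph (Fin k)) (ν : Fin n → Fin k)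
    (τ : Equiv.Perm (Fin n)) : Prop :=
  τ ^ 2 = 1 ∧ ∃ i j : Fin (k - 1) → Fin n,
    Function.Injective (Sum.elim i j) ∧
    τ = (List.ofFn fun l => Equiv.swap (i l) (j l)).prod ∧
    T.edgeSet = Set.range fun l => s(ν (i l), ν (j l))

open Classical in
/-- The set of splicing involutions indexed by `T` and `ν` that preserve the coloring `γ`. -/
noncomputable def coloredSplice {n k : ℕ} (T : SimpleGraph (Fin k)) (ν : Fin n → Fin k)
    (γ : Fin n → Fin n) : Finset (Equiv.Perm (Fin n)) :=
  {τ | IsSplice T ν τ ∧ γ ∘ τ = γ}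

open Classical in
/-- All enumerations `i` of `Fin n` with `i 0 = 0` such that `σ` is the `n`-cycle
`(i 0, i 1, …, i (n - 1))`. The addition `a + 1` in `Fin n` is cyclic. -/
noncomputable def cycleNotations {n : ℕ} [NeZero n] (σ : Equiv.Perm (Fin n)) :
    Finset (Fin n → Fin n) :=
  {i | Function.Injective i ∧ (∀ a, σ (i a) = i (a + 1)) ∧ i 0 = 0}

open Classical in
/-- The canonical splicing polynomial. -/
noncomputable def splicingPoly {n k : ℕ} [NeZero n] (θ : Equiv.Perm (Fin n)) (γ : Fin n → Fin n)
    (ν : Fin n → Fin k) (T : SimpleGraph (Fin k)) : FreeAlgebra ℂ (Fin n) :=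
  ∑ τ ∈ coloredSplice T ν γ, ∑ i ∈ cycleNotations (θ * τ),
    (List.ofFn fun a => FreeAlgebra.ι ℂ (i a) ^ (if i a = τ (i a) then 1 else 0)).prod

/-- The random noncommutative linear form `Z_T(i,j)`. Noncommutative polynomials with random
coefficients are polynomials over the ring of complex functions on the sample space. -/
noncomputable def randomVariable {k n : ℕ} (T : SimpleGraph (Fin k)) (i : Fin k) (j : Fin n) :
    FreeAlgebra ((T.edgeSet → ℝ) → ℂ) (Fin k × Fin n) :=
  ∑ i' : Fin k, (fun x => (sqrtWeight T x i i' : ℂ)) •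
    FreeAlgebra.ι ((T.edgeSet → ℝ) → ℂ) (i', j)

/-- The expectation, coefficient by coefficient, of a noncommutative polynomial with random
coefficients. -/
noncomputable def termwiseExpectation {Ω X : Type*} [MeasurableSpace Ω]
    (μ : MeasureTheory.Measure Ω) (P : FreeAlgebra (Ω → ℂ) X) : FreeAlgebra ℂ X :=
  FreeAlgebra.equivMonoidAlgebraFreeMonoid.symm <| MonoidAlgebra.ofCoeff <|
    Finsupp.mapRange (fun f : Ω → ℂ => ∫ ω, f ω ∂μ) (by simp)
      (FreeAlgebra.equivMonoidAlgebraFreeMonoid P).coeff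

open Classical in
/-- The polynomial `Arb_{θ,γ,ν}`. -/
noncomputable def arb {n k : ℕ} [NeZero n] (θ : Equiv.Perm (Fin n)) (γ : Fin n → Fin n)
    (ν : Fin n → Fin k) : FreeAlgebra ℂ (Fin k × Fin n) :=
  ∑ T : SimpleGraph (Fin k) with T.IsTree,
    termwiseExpectation (edgeLaw T)
      (FreeAlgebra.lift ℂ (fun s => randomVariable T (ν s) (γ s)) (splicingPoly θ γ ν T))

end Splicing

/-! ### Free standard semicircular families -/

section FreeProbability

open scoped ComplexOrder in
/-- `φ` is a faithful tracial state on the unital `C*`-algebra `A`. -/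
structure IsFaithfulTracialState {A : Type*} [CStarAlgebra A] (φ : A →ₗ[ℂ] ℂ) : Prop where
  map_one : φ 1 = 1
  nonneg : ∀ a, 0 ≤ φ (star a * a)
  faithful : ∀ a, φ (star a * a) = 0 → a = 0
  tracial : ∀ a b, φ (a * b) = φ (b * a)

/-- The unital subalgebras `B i` are free with respect to `φ`: any product of centered elements
in which neighboring factors come from different subalgebras is centered. -/
def AreFree {A ι : Type*} [Ring A] [Algebra ℂ A] (φ : A →ₗ[ℂ] ℂ) (B : ι → Subalgebra ℂ A) : Prop :=
  ∀ (m : ℕ) (i : Fin (m + 1) → ι) (a : Fin (m + 1) → A),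
    (∀ l : Fin m, i l.castSucc ≠ i l.succ) → (∀ l, a l ∈ B (i l)) → (∀ l, φ (a l) = 0) →
    φ (List.ofFn a).prod = 0

/-- `z` is self-adjoint and its moments are those of the semicircle law on `[-2, 2]`. -/
structure IsStandardSemicircular {A : Type*} [CStarAlgebra A] (φ : A →ₗ[ℂ] ℂ) (z : A) :
    Prop where
  isSelfAdjoint : IsSelfAdjoint z
  moment : ∀ m : ℕ, φ (z ^ m) =
    ((∫ t in (-2 : ℝ)..2, t ^ m * (√(4 - t ^ 2) / (2 * Real.pi)) : ℝ) : ℂ)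

/-- A free family of standard semicircular variables. -/
structure IsFreeSemicircularFamily {A ι : Type*} [CStarAlgebra A] (φ : A →ₗ[ℂ] ℂ) (z : ι → A) :
    Prop where
  semicircular : ∀ i, IsStandardSemicircular φ (z i)
  free : AreFree φ fun i => Algebra.adjoin ℂ {z i}

end FreeProbability

end PlanarMaps

namespace PlanarMaps

/-! ### The square root of a weight matrix -/

/-! The bound is a count of splicing involutions times a uniform bound on the monomial each
contributes.

Fix a tree and a value of the edge variables. The weight matrix is positive semidefinite with unit
diagonal, so each row of its square root is a real unit vector (`sum_sqrtWeight_sq`). Every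
substituted variable is then a combination of free standard semicirculars with unit coefficient
vector, hence has norm at most 2 (`IsFreeSemicircularFamily.norm_sum_smul_le`). An involution `τ`
contributes at most one monomial, because an `n`-cycle has only one notation with prescribed first
entry. Its nontrivial factors sit at the `n - 2(k - 1)` fixed points of `τ`, so its norm is at most
`2 ^ (n - 2(k - 1))`. Taking the expectation coefficient by coefficient amounts to integrating the
evaluated polynomial against a probability measure, which preserves the bound
(`norm_lift_termwiseExpectation_le`).

It remains to count pairs (tree, involution). An involution determines its tree, and forgetting both
the coloring and the `n`-cycle condition only increases the count. Root the tree and look at the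
available points of the root one by one. Each is either fixed, and then discarded, or joined to a
point of another vertex, which is then absorbed into the root. The resulting recursion is solved
exactly by `attachCount`, a product of vertex sizes times a falling factorial (`card_attachings_le`,
`sum_card_coloredSplice_le`).

The norm bound 2 comes from Chebyshev polynomials. Evaluated at a unit combination, they expand into
Wick products of words, which are centered by freeness. So the moments of the combination grow no
faster than `2 ^ m`, and faithfulness of the state converts this into a norm bound. -/

theorem sum_mul_mul_ite_eq_nonneg {ι β : Type*} [Fintype ι] [DecidableEq β] (f : ι → β)
    (x : ι → ℝ) : 0 ≤ ∑ i, ∑ j, x i * x j * (if f i = f j then 1 else 0) := by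
  have h : ∑ i, ∑ j, x i * x j * (if f i = f j then (1 : ℝ) else 0) =
      ∑ c ∈ Finset.univ.image f, (∑ i, if f i = c then x i else 0) ^ 2 := by
    simp_rw [sq, Finset.sum_mul_sum]
    rw [Finset.sum_comm' (t' := Finset.univ) (s' := fun _ => Finset.univ.image f) (by simp)]
    refine Finset.sum_congr rfl fun i _ => ?_
    rw [Finset.sum_comm]
    refine Finset.sum_congr rfl fun j _ => ?_
    rw [Finset.sum_eq_single (f i)]
    · by_cases h : f i = f j
      · simp [h]
      · simp [h, Ne.symm h]
    · intro b _ hb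
      simp [hb.symm]
    · intro h
      exact absurd (Finset.mem_image_of_mem f (Finset.mem_univ i)) h
  rw [h]
  exact Finset.sum_nonneg fun _ _ => sq_nonneg _

/-- Layer-cake argument: `A i j` is the integral over `t` in `[0, 1]` of the indicator of `t ≤ A i
j`. For each such `t` this is an equivalence relation, whose 0-1 matrix has as quadratic form a sum
of squares of class sums. -/
theorem IsCoUltrametric.posSemidef {k : ℕ} {A : Matrix (Fin k) (Fin k) ℝ}
    (hA : IsCoUltrametric A) : A.PosSemidef := by
  rw [Matrix.posSemidef_iff_dotProduct_mulVec]
  refine ⟨?_, fun x => ?_⟩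
  · ext i j
    simpa using hA.symm j i
  have hint : ∀ i j, A i j = ∫ t in (0 : ℝ)..1, Set.indicator (Set.Iic (A i j)) (fun _ => 1) t := by
    intro i j
    have h := hA.mem_Icc i j
    rw [intervalIntegral.integral_of_le zero_le_one,
      MeasureTheory.integral_indicator measurableSet_Iic,
      MeasureTheory.Measure.restrict_restrict measurableSet_Iic, Set.Iic_inter_Ioc_of_le h.2]
    simp [h.1]
  have hii : ∀ i j, IntervalIntegrable
      (fun t => x i * x j * Set.indicator (Set.Iic (A i j)) (fun _ => (1 : ℝ)) t)
      MeasureTheory.volume 0 1 := by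
    intro i j
    refine IntervalIntegrable.const_mul ?_ _
    rw [intervalIntegrable_iff_integrableOn_Ioc_of_le zero_le_one]
    exact (MeasureTheory.integrable_const _).indicator measurableSet_Iic
  have hsum : star x ⬝ᵥ (A.mulVec x) = ∫ t in (0 : ℝ)..1, ∑ i, ∑ j,
      x i * x j * Set.indicator (Set.Iic (A i j)) (fun _ => (1 : ℝ)) t := by
    rw [intervalIntegral.integral_finsetSum]
    · simp only [dotProduct, Matrix.mulVec, Finset.mul_sum]
      refine Finset.sum_congr rfl fun i _ => ?_
      rw [intervalIntegral.integral_finsetSum fun j _ => hii i j]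
      refine Finset.sum_congr rfl fun j _ => ?_
      rw [intervalIntegral.integral_const_mul, ← hint i j]
      simp only [star_trivial]
      ring
    · intro i _
      have h := IntervalIntegrable.sum Finset.univ fun j _ => hii i j
      rwa [Finset.sum_fn] at h
  rw [hsum]
  refine intervalIntegral.integral_nonneg zero_le_one fun t ht => ?_
  classical
  -- Each index is labelled by its equivalence class at level `t`; two indices are related exactly
  -- when these classes coincide.
  convert sum_mul_mul_ite_eq_nonneg (fun i => Finset.univ.filter fun j => t ≤ A i j) x using 6
      with i _ j _
  rw [Set.indicator_apply]
  congr 1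
  rw [Set.mem_Iic, eq_iff_iff]
  constructor
  · intro h
    ext l
    simp only [Finset.mem_filter, Finset.mem_univ, true_and]
    constructor
    · exact fun h' => (le_min (hA.symm i j ▸ h) h').trans (hA.min_le j i l)
    · exact fun h' => (le_min h h').trans (hA.min_le i j l)
  · intro h
    have : j ∈ Finset.univ.filter fun l => t ≤ A j l := by simp [hA.diag, ht.2]
    rw [← h] at this
    simpa using this

theorem isCoUltrametric_one {k : ℕ} : IsCoUltrametric (1 : Matrix (Fin k) (Fin k) ℝ) := by
  refine ⟨fun i j => ?_, by simp, fun i j => ?_, fun i j l => ?_⟩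
  · simp [Matrix.one_apply, eq_comm]
  · by_cases h : i = j <;> simp [h, Matrix.one_apply]
  · by_cases h : i = j
    · subst h; simp
    · by_cases h' : i = l
      · subst h'; simp [Matrix.one_apply_ne h]
      · simp [Matrix.one_apply_ne h, Matrix.one_apply_ne h']

/-- The default value `1` of `weight` is itself a co-ultrametric, so the norm estimates hold at
every sample point; exceptional null sets matter only for measurability. -/
theorem isCoUltrametric_weight {k : ℕ} (T : SimpleGraph (Fin k)) (x : T.edgeSet → ℝ) :
    IsCoUltrametric (weight T x) := by
  rw [weight]
  split_ifs with h
  · exact h.choose_spec.isCoUltrametric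
  · exact isCoUltrametric_one

open scoped MatrixOrder in
theorem posSemidef_sqrtWeight {k : ℕ} (T : SimpleGraph (Fin k)) (x : T.edgeSet → ℝ) :
    (sqrtWeight T x).PosSemidef :=
  Matrix.nonneg_iff_posSemidef.1 (CFC.sqrt_nonneg _)

open scoped MatrixOrder in
theorem sqrtWeight_mul_sqrtWeight {k : ℕ} (T : SimpleGraph (Fin k)) (x : T.edgeSet → ℝ) :
    sqrtWeight T x * sqrtWeight T x = weight T x :=
  CFC.sqrt_mul_sqrt_self _ (isCoUltrametric_weight T x).posSemidef.nonneg

theorem sum_sqrtWeight_sq {k : ℕ} (T : SimpleGraph (Fin k)) (x : T.edgeSet → ℝ) (i : Fin k) :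
    ∑ j, sqrtWeight T x i j ^ 2 = 1 := by
  rw [← (isCoUltrametric_weight T x).diag i, ← sqrtWeight_mul_sqrtWeight, Matrix.mul_apply]
  refine Finset.sum_congr rfl fun j _ => ?_
  rw [sq, ← (posSemidef_sqrtWeight T x).isHermitian.apply i j]
  simp

theorem abs_sqrtWeight_le_one {k : ℕ} (T : SimpleGraph (Fin k)) (x : T.edgeSet → ℝ)
    (i j : Fin k) : |sqrtWeight T x i j| ≤ 1 := by
  rw [← sq_le_one_iff_abs_le_one, ← sum_sqrtWeight_sq T x i]
  exact Finset.single_le_sum (f := fun j => sqrtWeight T x i j ^ 2) (fun _ _ => sq_nonneg _)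
    (Finset.mem_univ j)

/-! ### The law of the edge variables, and measurability of the weight matrix and its square root.
-/

theorem measurable_walkMin {k : ℕ} {T : SimpleGraph (Fin k)} {i j : Fin k} (p : T.Walk i j) :
    Measurable fun x : T.edgeSet → ℝ => walkMin x p := by
  induction p with
  | nil => exact measurable_const
  | cons h p ih => exact (measurable_pi_apply _).min ih

theorem edgeLaw_eq {k : ℕ} (T : SimpleGraph (Fin k)) [Fintype T.edgeSet] :
    edgeLaw T = (MeasureTheory.volume : MeasureTheory.Measure (T.edgeSet → ℝ)).restrict
      (Set.univ.pi fun _ => Set.Ioo 0 1) := by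
  rw [MeasureTheory.volume_pi, MeasureTheory.Measure.restrict_pi_pi, edgeLaw]
  congr!

instance isProbabilityMeasure_edgeLaw {k : ℕ} (T : SimpleGraph (Fin k)) :
    MeasureTheory.IsProbabilityMeasure (edgeLaw T) := by
  have : Fintype T.edgeSet := Fintype.ofFinite _
  rw [edgeLaw_eq]
  refine ⟨?_⟩
  rw [MeasureTheory.Measure.restrict_apply_univ, MeasureTheory.volume_pi_pi]
  simp

theorem ae_edgeLaw {k : ℕ} (T : SimpleGraph (Fin k)) :
    ∀ᵐ x ∂edgeLaw T, Function.Injective x ∧ ∀ e, x e ∈ Set.Ioo (0 : ℝ) 1 := by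
  have : Fintype T.edgeSet := Fintype.ofFinite _
  rw [edgeLaw_eq]
  have h1 : ∀ᵐ x : T.edgeSet → ℝ ∂MeasureTheory.volume, Function.Injective x := by
    have h : ∀ e e' : T.edgeSet, e ≠ e' →
        ∀ᵐ x : T.edgeSet → ℝ ∂MeasureTheory.volume, x e ≠ x e' := by
      classical
      intro e e' hne
      -- A coincidence `x e = x e'` confines `x` to a proper linear subspace, which is Lebesgue
      -- null.
      have := MeasureTheory.Measure.addHaar_submodule
        (MeasureTheory.volume : MeasureTheory.Measure (T.edgeSet → ℝ))
        (LinearMap.ker ((LinearMap.proj e : (T.edgeSet → ℝ) →ₗ[ℝ] ℝ) - LinearMap.proj e')) ?_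
      · rw [MeasureTheory.ae_iff]
        convert this using 2
        ext x
        simp [sub_eq_zero]
      · intro h
        have h' : Pi.single e (1 : ℝ) ∈
            LinearMap.ker ((LinearMap.proj e : (T.edgeSet → ℝ) →ₗ[ℝ] ℝ) - LinearMap.proj e') := by
          rw [h]; trivial
        simp [Pi.single_eq_of_ne hne.symm] at h'
    have h' : ∀ᵐ x : T.edgeSet → ℝ ∂MeasureTheory.volume, ∀ e e', e ≠ e' → x e ≠ x e' := by
      simpa [MeasureTheory.ae_all_iff] using h
    filter_upwards [h'] with x hx e e' hee
    by_contra hne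
    exact hx e e' hne hee
  have hm : MeasurableSet (Set.univ.pi fun _ : T.edgeSet => Set.Ioo (0 : ℝ) 1) :=
    MeasurableSet.univ_pi fun _ => measurableSet_Ioo
  filter_upwards [MeasureTheory.ae_restrict_of_ae h1, MeasureTheory.ae_restrict_mem hm]
    with x hx hx'
  exact ⟨hx, fun e => hx' e trivial⟩

theorem aemeasurable_weight {k : ℕ} {T : SimpleGraph (Fin k)} (hT : T.IsTree) :
    AEMeasurable (fun x (i j : Fin k) => weight T x i j) (edgeLaw T) := by
  choose P hP hPu using fun i j => hT.existsUnique_path i j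
  refine ⟨fun x i j => walkMin x (P i j),
    measurable_pi_lambda _ fun i => measurable_pi_lambda _ fun j => measurable_walkMin _, ?_⟩
  filter_upwards [ae_edgeLaw T] with x hx
  obtain ⟨A, -, hu, hA⟩ := existsUnique_isWeight hT hx.1 hx.2
  ext i j
  rw [hu _ (isWeight_weight hT hx.1 hx.2), hA i j _ (hP i j)]

-- Squaring is a continuous injection on the compact set of positive semidefinite matrices with
-- entries in `[-1, 1]`, hence a closed embedding. Measurability of the square root thus follows
-- from that of the weight matrix.
open scoped MatrixOrder in
theorem aemeasurable_sqrtWeight {k : ℕ} {T : SimpleGraph (Fin k)} (hT : T.IsTree) (i j : Fin k) :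
    AEMeasurable (fun x => sqrtWeight T x i j) (edgeLaw T) := by
  let K : Set (Fin k → Fin k → ℝ) :=
    {S | (Matrix.of S).PosSemidef ∧ ∀ i j, S i j ∈ Set.Icc (-1 : ℝ) 1}
  have hK : IsCompact K := by
    have h1 : IsCompact (Set.univ.pi fun _ : Fin k => Set.univ.pi fun _ : Fin k =>
        Set.Icc (-1 : ℝ) 1) :=
      isCompact_univ_pi fun _ => isCompact_univ_pi fun _ => isCompact_Icc
    have h2 : IsClosed {S : Fin k → Fin k → ℝ | (Matrix.of S).PosSemidef} := by
      simp only [Matrix.posSemidef_iff_dotProduct_mulVec, Set.ofPred_and, Set.ofPred_forall,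
        Matrix.IsHermitian]
      refine IsClosed.inter ?_ (isClosed_iInter fun x => ?_)
      · refine isClosed_eq ?_ ?_
        · refine continuous_pi fun a => continuous_pi fun b => ?_
          simp only [Matrix.conjTranspose_apply, Matrix.of_apply]
          fun_prop
        · refine continuous_pi fun a => continuous_pi fun b => ?_
          simp only [Matrix.of_apply]
          fun_prop
      · refine isClosed_le continuous_const ?_
        simp only [dotProduct, Matrix.mulVec, Matrix.of_apply]
        fun_prop
    convert h1.inter_left h2 using 1
    ext S
    simp only [K, Set.mem_ofPred_eq, Set.mem_inter_iff, Set.mem_pi, Set.mem_univ, true_imp_iff]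
  have : CompactSpace K := isCompact_iff_compactSpace.1 hK
  let f : K → Fin k → Fin k → ℝ := fun S i j => ∑ l, S.1 i l * S.1 l j
  have hf : Continuous f := by
    refine continuous_pi fun a => continuous_pi fun b => ?_
    refine continuous_finsetSum _ fun l _ => ?_
    exact ((continuous_apply_apply a l).comp continuous_subtype_val).mul
      ((continuous_apply_apply l b).comp continuous_subtype_val)
  have hinj : Function.Injective f := by
    intro S S' h
    have h' : Matrix.of S.1 * Matrix.of S.1 = Matrix.of S'.1 * Matrix.of S'.1 := by
      ext a b
      exact congrFun (congrFun h a) b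
    have h1 := CFC.sqrt_mul_self _ S.2.1.nonneg
    rw [h', CFC.sqrt_mul_self _ S'.2.1.nonneg] at h1
    exact Subtype.ext (Matrix.of.injective h1.symm)
  have hemb := (hf.isClosedEmbedding hinj).measurableEmbedding
  let σ : (T.edgeSet → ℝ) → K := fun x => ⟨fun i j => sqrtWeight T x i j,
    posSemidef_sqrtWeight T x, fun i j => abs_le.1 (abs_sqrtWeight_le_one T x i j)⟩
  have hσ : AEMeasurable σ (edgeLaw T) := by
    rw [← hemb.aemeasurable_comp_iff]
    convert aemeasurable_weight hT using 1
    ext x a b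
    rw [← sqrtWeight_mul_sqrtWeight, Matrix.mul_apply]
    rfl
  exact ((measurable_pi_apply j).comp ((measurable_pi_apply i).comp
    measurable_subtype_coe)).comp_aemeasurable hσ

/-! ### Norms of linear combinations of free semicircular elements -/

section Semicircular

open Polynomial Polynomial.Chebyshev

theorem integral_cos_natCast_succ_mul (m : ℕ) :
    ∫ θ in (0 : ℝ)..Real.pi, Real.cos ((m + 1 : ℕ) * θ) = 0 := by
  have hm : ((m + 1 : ℕ) : ℝ) ≠ 0 := by positivity
  rw [intervalIntegral.integral_comp_mul_left (fun θ => Real.cos θ) hm, integral_cos]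
  simp only [mul_zero, Real.sin_zero, Real.sin_nat_mul_pi, sub_self, smul_zero]

/-- The Chebyshev polynomials of positive degree are centered under the semicircle law. -/
theorem integral_chebyshev_semicircle (m : ℕ) :
    ∫ t in (-2 : ℝ)..2, (S ℝ (m + 1 : ℕ)).eval t * (√(4 - t ^ 2) / (2 * Real.pi)) = 0 := by
  set g : ℝ → ℝ := fun t => (S ℝ (m + 1 : ℕ)).eval t * (√(4 - t ^ 2) / (2 * Real.pi)) with hg
  have hgc : Continuous g := by
    refine (Polynomial.continuous _).mul ?_
    fun_prop
  have h1 : ∫ θ in (0 : ℝ)..Real.pi, (g ∘ fun θ => 2 * Real.cos θ) θ * (2 * -Real.sin θ) =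
      ∫ t in (2 * Real.cos 0)..(2 * Real.cos Real.pi), g t := by
    refine intervalIntegral.integral_comp_mul_deriv (fun θ _ => ?_) ?_ hgc
    · exact (Real.hasDerivAt_cos θ).const_mul 2
    · fun_prop
  -- Under `t = 2 cos θ`, the Chebyshev polynomial times `sin θ` is `sin ((m + 2) θ)`; the other
  -- `sin θ` turns it into a difference of two cosines of positive frequency.
  have h2 : ∀ θ ∈ Set.uIcc (0 : ℝ) Real.pi, (g ∘ fun θ => 2 * Real.cos θ) θ * (2 * -Real.sin θ) =
      (1 / Real.pi) * (Real.cos ((m + 3 : ℕ) * θ) - Real.cos ((m + 1 : ℕ) * θ)) := by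
    intro θ hθ
    rw [Set.uIcc_of_le Real.pi_pos.le] at hθ
    have hs : 0 ≤ Real.sin θ := Real.sin_nonneg_of_mem_Icc hθ
    have hsq : √(4 - (2 * Real.cos θ) ^ 2) = 2 * Real.sin θ := by
      rw [← Real.sqrt_sq (by positivity : 0 ≤ 2 * Real.sin θ)]
      congr 1
      have := Real.sin_sq_add_cos_sq θ
      linear_combination -4 * this
    have hS := S_two_mul_real_cos θ (m + 1 : ℕ)
    simp only [hg, Function.comp, hsq]
    have e1 : ((m + 3 : ℕ) : ℝ) * θ = ((m + 1 : ℕ) + 1 : ℝ) * θ + θ := by push_cast; ring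
    have e2 : ((m + 1 : ℕ) : ℝ) * θ = ((m + 1 : ℕ) + 1 : ℝ) * θ - θ := by push_cast; ring
    rw [e1, e2, Real.cos_add, Real.cos_sub]
    push_cast at hS ⊢
    rw [← hS]
    field_simp
    ring
  rw [intervalIntegral.integral_congr h2, intervalIntegral.integral_const_mul,
    intervalIntegral.integral_sub, integral_cos_natCast_succ_mul m,
    integral_cos_natCast_succ_mul (m + 2)] at h1
  · rw [sub_self, mul_zero, Real.cos_zero, Real.cos_pi, mul_one, mul_neg_one] at h1
    rw [intervalIntegral.integral_symm, neg_eq_zero]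
    exact h1.symm
  · exact Continuous.intervalIntegrable (by fun_prop) _ _
  · exact Continuous.intervalIntegrable (by fun_prop) _ _

variable {A : Type*} [CStarAlgebra A] {φ : A →ₗ[ℂ] ℂ}

theorem IsStandardSemicircular.map_aeval {z : A} (hz : IsStandardSemicircular φ z) (p : ℝ[X]) :
    φ (aeval z (p.map (algebraMap ℝ ℂ))) =
      ((∫ t in (-2 : ℝ)..2, p.eval t * (√(4 - t ^ 2) / (2 * Real.pi)) : ℝ) : ℂ) := by
  induction p using Polynomial.induction_on' with
  | add p q hp hq =>
    rw [Polynomial.map_add, map_add, map_add, hp, hq, ← Complex.ofReal_add,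
      ← intervalIntegral.integral_add]
    · simp only [eval_add, add_mul]
    · exact Continuous.intervalIntegrable ((Polynomial.continuous _).mul (by fun_prop)) _ _
    · exact Continuous.intervalIntegrable ((Polynomial.continuous _).mul (by fun_prop)) _ _
  | monomial m a =>
    rw [Polynomial.map_monomial, aeval_monomial, ← Algebra.smul_def, map_smul, hz.moment]
    simp only [eval_monomial, mul_assoc, intervalIntegral.integral_const_mul, smul_eq_mul,
      Complex.ofReal_mul, Complex.coe_algebraMap]

theorem IsStandardSemicircular.map_chebyshev {z : A} (hz : IsStandardSemicircular φ z) (m : ℕ) :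
    φ (aeval z (S ℂ (m + 1 : ℕ))) = 0 := by
  rw [← map_S (algebraMap ℝ ℂ), hz.map_aeval, integral_chebyshev_semicircle, Complex.ofReal_zero]

theorem AreFree.map_prod_eq_zero {B ι : Type*} [Ring B] [Algebra ℂ B] {ψ : B →ₗ[ℂ] ℂ}
    {C : ι → Subalgebra ℂ B} (h : AreFree ψ C) {L : List (ι × B)} (hL : L ≠ [])
    (hchain : L.IsChain fun a b => a.1 ≠ b.1) (hmem : ∀ a ∈ L, a.2 ∈ C a.1)
    (hzero : ∀ a ∈ L, ψ a.2 = 0) : ψ (L.map Prod.snd).prod = 0 := by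
  obtain ⟨m, hm⟩ : ∃ m, L.length = m + 1 :=
    Nat.exists_eq_succ_of_ne_zero fun h0 => hL (List.length_eq_zero_iff.1 h0)
  have := h m (fun l => (L.get (l.cast hm.symm)).1) (fun l => (L.get (l.cast hm.symm)).2)
    (fun l => List.isChain_iff_getElem.1 hchain l (by simp [hm]))
    (fun l => hmem _ (List.get_mem _ _)) (fun l => hzero _ (List.get_mem _ _))
  convert this using 3
  refine List.ext_get (by simp [hm]) fun i h1 h2 => ?_
  simp only [List.get_eq_getElem, List.getElem_map, List.getElem_ofFn, Fin.val_cast]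

open Classical in
/-- The Wick product of a word in the letters `z i`. -/
noncomputable def wick {ι : Type*} (z : ι → A) : List ι → A
  | [] => 1
  | [i] => z i
  | i :: j :: I => z i * wick z (j :: I) - if i = j then wick z I else 0

/-- The Wick product of a word is the product, over its maximal runs of equal letters, of Chebyshev
polynomials in those letters. Here `m + 1` is the length of the first run and `L` lists the factors
of the later runs. The factorization of `wick z J` is carried along because the Wick recursion
reaches back two steps. -/
theorem exists_wick_eq {ι : Type*} (z : ι → A)
    (hz : ∀ i (m : ℕ), φ (aeval (z i) (S ℂ (m + 1 : ℕ))) = 0) (i : ι) (J : List ι) :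
    ∃ (m : ℕ) (L : List (ι × A)),
      wick z (i :: J) = aeval (z i) (S ℂ (m + 1 : ℕ)) * (L.map Prod.snd).prod ∧
      wick z J = aeval (z i) (S ℂ (m : ℕ)) * (L.map Prod.snd).prod ∧
      (∀ x : A, List.IsChain (fun a b : ι × A => a.1 ≠ b.1) ((i, x) :: L)) ∧
      (∀ a ∈ L, a.2 ∈ Algebra.adjoin ℂ {z a.1}) ∧ ∀ a ∈ L, φ a.2 = 0 := by
  induction J generalizing i with
  | nil => exact ⟨0, [], by simp [wick], by simp [wick], by simp, by simp, by simp⟩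
  | cons j J ih =>
    obtain ⟨m, L, h1, h2, h3, h4, h5⟩ := ih j
    by_cases hij : i = j
    · subst hij
      refine ⟨m + 1, L, ?_, h1, h3, h4, h5⟩
      have hS := S_add_two ℂ m
      rw [wick, if_pos rfl, h1, h2, ← mul_assoc, ← sub_mul]
      push_cast at hS ⊢
      rw [add_assoc, one_add_one_eq_two, hS]
      simp
    · refine ⟨0, (j, aeval (z j) (S ℂ (m + 1 : ℕ))) :: L, ?_, ?_, fun x => ?_, ?_, ?_⟩
      · simp [wick, hij, h1]
      · simp [h1]
      · exact List.IsChain.cons_cons hij (h3 _)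
      · intro a ha
        rcases List.mem_cons.1 ha with rfl | ha
        · exact aeval_mem_adjoin_singleton ℂ (z j)
        · exact h4 a ha
      · intro a ha
        rcases List.mem_cons.1 ha with rfl | ha
        · exact hz _ _
        · exact h5 a ha

theorem IsFreeSemicircularFamily.map_wick_cons {ι : Type*} {z : ι → A}
    (hz : IsFreeSemicircularFamily φ z) (i : ι) (J : List ι) : φ (wick z (i :: J)) = 0 := by
  have hc := fun i => (hz.semicircular i).map_chebyshev
  obtain ⟨m, L, h1, -, h3, h4, h5⟩ := exists_wick_eq z hc i J
  rw [h1]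
  refine hz.free.map_prod_eq_zero (L := (i, aeval (z i) (S ℂ (m + 1 : ℕ))) :: L) (by simp)
    (h3 _) ?_ ?_
  · intro a ha
    rcases List.mem_cons.1 ha with rfl | ha
    · exact aeval_mem_adjoin_singleton ℂ (z i)
    · exact h4 a ha
  · intro a ha
    rcases List.mem_cons.1 ha with rfl | ha
    · exact hc _ _
    · exact h5 a ha

/-- The sum of `c i₁ ⋯ c iₘ • f [i₁, …, iₘ]` over all words of length `m`. -/
noncomputable def wordSum {ι : Type*} [Fintype ι] (c : ι → ℂ) : ℕ → (List ι → A) → A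
  | 0, f => f []
  | m + 1, f => ∑ i, c i • wordSum c m fun I => f (i :: I)

theorem wordSum_mul_sub {ι : Type*} [Fintype ι] (c : ι → ℂ) (m : ℕ) (a : A) (t : ℂ)
    (f g : List ι → A) :
    wordSum c m (fun I => a * f I - t • g I) = a * wordSum c m f - t • wordSum c m g := by
  induction m generalizing f g with
  | zero => rfl
  | succ m ih =>
    simp only [wordSum, ih, smul_sub, Finset.sum_sub_distrib, Finset.mul_sum, Finset.smul_sum,
      mul_smul_comm, smul_comm t]

theorem map_wordSum_eq_zero {ι : Type*} [Fintype ι] (c : ι → ℂ) (m : ℕ) (f : List ι → A)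
    (hf : ∀ I, φ (f I) = 0) : φ (wordSum c m f) = 0 := by
  induction m generalizing f with
  | zero => exact hf _
  | succ m ih =>
    simp only [wordSum, map_sum, map_smul]
    exact Finset.sum_eq_zero fun i _ => by rw [ih _ fun I => hf _, smul_zero]

/-- A linear combination of the `z i` with unit coefficient vector acts on sums of Wick products
like a single variable. -/
theorem aeval_chebyshev_eq_wordSum {ι : Type*} [Fintype ι] (z : ι → A) (c : ι → ℂ)
    (hc : ∑ i, c i ^ 2 = 1) (m : ℕ) :
    aeval (∑ i, c i • z i) (S ℂ m) = wordSum c m (wick z) := by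
  classical
  induction m using Nat.twoStepInduction with
  | zero => simp [wordSum, wick]
  | one => simp [wordSum, wick]
  | more m ih1 ih2 =>
    have hS := S_add_two ℂ m
    push_cast at hS ih2 ⊢
    rw [hS, map_sub, map_mul, aeval_X, ih1, ih2]
    have h : ∀ i j, wordSum c m (fun I => wick z (i :: j :: I)) =
        z i * wordSum c m (fun I => wick z (j :: I)) -
          (if i = j then (1 : ℂ) else 0) • wordSum c m (wick z) := by
      intro i j
      rw [← wordSum_mul_sub]
      congr 1
      ext I
      simp [wick]
    simp only [wordSum, h, smul_sub, Finset.sum_sub_distrib]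
    congr 1
    · simp only [Finset.sum_mul, Finset.mul_sum, Finset.smul_sum, smul_mul_assoc, mul_smul_comm]
      rw [Finset.sum_comm]
      simp only [smul_comm (c _) (c _)]
    -- The contractions `i = j` collect the factor `∑ c i ^ 2 = 1`, so the remainder is exactly the
    -- lower term of the Chebyshev recursion.
    · simp only [ite_smul, one_smul, zero_smul, smul_ite, smul_zero, Finset.sum_ite_eq,
        Finset.mem_univ, if_true, smul_smul, ← sq, ← Finset.sum_smul, hc]

theorem IsFreeSemicircularFamily.map_aeval_chebyshev {ι : Type*} [Fintype ι] {z : ι → A}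
    (hz : IsFreeSemicircularFamily φ z) (c : ι → ℂ) (hc : ∑ i, c i ^ 2 = 1) (m : ℕ) :
    φ (aeval (∑ i, c i • z i) (S ℂ (m + 1 : ℕ))) = 0 := by
  rw [aeval_chebyshev_eq_wordSum z c hc]
  simp only [wordSum, map_sum, map_smul]
  refine Finset.sum_eq_zero fun i _ => ?_
  rw [map_wordSum_eq_zero c m _ fun I => hz.map_wick_cons i I, smul_zero]

/-! ### From Chebyshev moments to operator norms. -/

theorem norm_map_pow_le {w : A} (hφ : φ 1 = 1) (hw : ∀ m : ℕ, φ (aeval w (S ℂ (m + 1 : ℕ))) = 0)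
    (m : ℕ) : ‖φ (w ^ m)‖ ≤ 2 ^ m := by
  -- Multiplication by `w` sends the Chebyshev polynomial of index `l + 1` to the sum of its two
  -- neighbors, and that of index 0 to that of index 1. Each factor `w` therefore at most doubles
  -- the bound, provided all `l` are treated at once.
  have key : ∀ m l : ℕ, ‖φ (w ^ m * aeval w (S ℂ l))‖ ≤ 2 ^ m := by
    intro m
    induction m with
    | zero =>
      rintro (_ | l)
      · simp [hφ]
      · simp only [pow_zero, one_mul, hw]; simp
    | succ m ih =>
      rintro (_ | l)
      · have := ih 1
        simp only [Nat.cast_one, S_one, aeval_X, ← pow_succ] at this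
        simp only [Nat.cast_zero, S_zero, map_one, mul_one]
        exact this.trans (by gcongr <;> simp)
      · have hS := S_add_two ℂ l
        have e : w ^ (m + 1) * aeval w (S ℂ (l + 1 : ℕ)) =
            w ^ m * aeval w (S ℂ (l + 2 : ℕ)) + w ^ m * aeval w (S ℂ l) := by
          push_cast
          rw [hS, map_sub, map_mul, aeval_X, pow_succ, mul_sub, sub_add_cancel, mul_assoc]
        rw [e, map_add, pow_succ, mul_two]
        exact (norm_add_le _ _).trans (add_le_add (ih _) (ih _))
  simpa using key m 0

/-- If the norm exceeded some `D > C`, a bump function `g` supported on `|t| ≥ D` would be nonzero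
at `w`, so by faithfulness `g(w) ^ 2` would have positive mass `ε`. The even moments would then be
at least `D ^ (2m) * ε`, outgrowing `C ^ (2m)`. -/
theorem IsFaithfulTracialState.norm_le_of_norm_map_pow_le (hφ : IsFaithfulTracialState φ)
    {w : A} (hw : IsSelfAdjoint w) {C : ℝ} (hC : 0 < C) (h : ∀ m, ‖φ (w ^ m)‖ ≤ C ^ m) :
    ‖w‖ ≤ C := by
  have : Nontrivial A := by
    refine ⟨⟨1, 0, fun h => ?_⟩⟩
    have h1 := hφ.map_one
    rw [h, map_zero] at h1
    exact zero_ne_one h1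
  by_contra! hlt
  obtain ⟨D, hCD, hDw⟩ := exists_between hlt
  have hD : 0 < D := hC.trans hCD
  set g : ℝ → ℝ := fun t => min 1 (max (|t| - D) 0) with hg
  have hgc : Continuous g := by fun_prop
  have hg0 : ∀ t, 0 ≤ g t := fun t => le_min zero_le_one (le_max_right _ _)
  have hg1 : ∀ t, g t ≤ 1 := fun t => min_le_left _ _
  have hne : cfc g w ≠ 0 := by
    intro h0
    have h1 := norm_cfc_le_iff g w (le_refl (0 : ℝ)) hgc.continuousOn hw
    rw [h0, norm_zero] at h1
    have h2 : ‖cfc (id : ℝ → ℝ) w‖ ≤ D := by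
      refine norm_cfc_le hD.le fun t ht => ?_
      have h3 := h1.1 le_rfl t ht
      rw [norm_le_zero_iff] at h3
      by_contra! h4
      have : 0 < g t := lt_min one_pos (lt_max_of_lt_left (sub_pos.2 h4))
      exact this.ne' h3
    rw [cfc_id ℝ w] at h2
    exact absurd hDw (not_lt.2 h2)
  have hpos : ∀ f : ℝ → ℝ, 0 ≤ (φ (cfc f w * cfc f w)).re := by
    intro f
    have := hφ.nonneg (cfc f w)
    rw [(cfc_predicate f w : IsSelfAdjoint (cfc f w)).star_eq] at this
    exact (Complex.le_def.1 this).1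
  have hε : 0 < (φ (cfc g w * cfc g w)).re := by
    refine lt_of_le_of_ne (hpos g) fun h0 => hne (hφ.faithful _ ?_)
    have h1 := hφ.nonneg (cfc g w)
    rw [(cfc_predicate g w : IsSelfAdjoint (cfc g w)).star_eq] at h1 ⊢
    exact Complex.ext h0.symm (Complex.le_def.1 h1).2.symm
  set ε := (φ (cfc g w * cfc g w)).re
  have hkey : ∀ m : ℕ, (D ^ 2) ^ m * ε ≤ (C ^ 2) ^ m := by
    intro m
    have hle : ∀ t : ℝ, 0 ≤ t ^ (2 * m) - D ^ (2 * m) * g t ^ 2 := by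
      intro t
      rw [sub_nonneg]
      by_cases ht : |t| ≤ D
      · have : g t = 0 := by
          simp only [hg]
          rw [max_eq_right (by linarith)]
          simp
        rw [this, zero_pow two_ne_zero, mul_zero, pow_mul]
        positivity
      · push Not at ht
        calc D ^ (2 * m) * g t ^ 2 ≤ |t| ^ (2 * m) * 1 := by
              gcongr
              exact pow_le_one₀ (hg0 t) (hg1 t)
          _ = t ^ (2 * m) := by rw [mul_one, pow_mul, sq_abs, ← pow_mul]
    set f : ℝ → ℝ := fun t => √(t ^ (2 * m) - D ^ (2 * m) * g t ^ 2) with hf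
    have hfc : Continuous f := by fun_prop
    -- Positivity of the state is available for squares, so the nonnegative difference is written as
    -- the square of its root `f`.
    have hdecomp : w ^ (2 * m) = cfc f w * cfc f w + (D ^ (2 * m) : ℝ) • (cfc g w * cfc g w) := by
      rw [← cfc_mul f f w hfc.continuousOn hfc.continuousOn,
        ← cfc_mul g g w hgc.continuousOn hgc.continuousOn,
        ← cfc_smul (D ^ (2 * m) : ℝ) (fun t => g t * g t) w (by fun_prop),
        ← cfc_add (a := w) (fun t => f t * f t) _ (by fun_prop) (by fun_prop),
        ← cfc_pow_id (R := ℝ) w (2 * m)]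
      congr 1
      ext t
      simp only [hf, Real.mul_self_sqrt (hle t), smul_eq_mul]
      ring
    have h1 : (φ (w ^ (2 * m))).re = (φ (cfc f w * cfc f w)).re + D ^ (2 * m) * ε := by
      rw [hdecomp, map_add, Complex.add_re, ← Complex.coe_smul, map_smul, smul_eq_mul,
        Complex.re_ofReal_mul]
    have h2 := (Complex.re_le_norm _).trans (h (2 * m))
    rw [h1] at h2
    rw [← pow_mul, ← pow_mul]
    linarith [hpos f]
  have hr : C ^ 2 / D ^ 2 < 1 := by
    rw [div_lt_one (by positivity)]
    gcongr
  obtain ⟨m, hm⟩ := exists_pow_lt_of_lt_one hε hr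
  rw [div_pow, div_lt_iff₀ (by positivity)] at hm
  linarith [hkey m]

theorem IsFreeSemicircularFamily.norm_sum_smul_le {ι : Type*} [Fintype ι] {z : ι → A}
    (hφ : IsFaithfulTracialState φ) (hz : IsFreeSemicircularFamily φ z) (c : ι → ℝ)
    (hc : ∑ i, c i ^ 2 = 1) : ‖∑ i, (c i : ℂ) • z i‖ ≤ 2 := by
  refine hφ.norm_le_of_norm_map_pow_le ?_ two_pos
    (norm_map_pow_le hφ.map_one (hz.map_aeval_chebyshev _ (by exact_mod_cast hc)))
  refine isSelfAdjoint_sum _ fun i _ => ?_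
  exact IsSelfAdjoint.smul (Complex.conj_ofReal _) (hz.semicircular i).isSelfAdjoint

end Semicircular

/-! ### Counting splicing involutions -/

section Counting

variable {V S : Type*} [DecidableEq S]

/-- Multiplying an involution by the transposition of `p` and its partner deletes that pair and
leaves the rest alone. This is the basic move of the count. -/
theorem mul_swap_apply_eq {τ : Equiv.Perm S} (h : ∀ x, τ (τ x) = x) (p x : S) :
    (τ * Equiv.swap p (τ p)) x = if x = p ∨ x = τ p then x else τ x := by
  rw [Equiv.Perm.mul_apply]
  split_ifs with hx
  · rcases hx with rfl | rfl
    · rw [Equiv.swap_apply_left, h]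
    · rw [Equiv.swap_apply_right]
  · push Not at hx
    rw [Equiv.swap_apply_of_ne_of_ne hx.1 hx.2]

theorem mul_swap_involutive {τ : Equiv.Perm S} (h : ∀ x, τ (τ x) = x) (p x : S) :
    (τ * Equiv.swap p (τ p)) ((τ * Equiv.swap p (τ p)) x) = x := by
  have h1 : τ x = p ↔ x = τ p := by rw [← h p, EmbeddingLike.apply_eq_iff_eq, h p]
  have h2 : τ x = τ p ↔ x = p := EmbeddingLike.apply_eq_iff_eq _
  rw [mul_swap_apply_eq h p x]
  split_ifs with hx
  · rw [mul_swap_apply_eq h, if_pos hx]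
  · rw [mul_swap_apply_eq h, if_neg, h]
    rw [h1, h2, or_comm]
    exact hx

theorem leaves_mul_swap {ν : S → V} {W : Finset V} {τ : Equiv.Perm S} (h : ∀ x, τ (τ x) = x)
    (hl : ∀ U ⊆ W, U.Nonempty → ∃ x, ν x ∈ U ∧ ν (τ x) ∉ U) {p : S} {W' : Finset V} (hW : W' ⊆ W)
    (hp : ν p ∉ W') (hp' : ν (τ p) ∉ W') :
    ∀ U ⊆ W', U.Nonempty →
      ∃ x, ν x ∈ U ∧ ν ((τ * Equiv.swap p (τ p)) x) ∉ U := by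
  intro U hU hne
  obtain ⟨x, hx, hx'⟩ := hl U (hU.trans hW) hne
  refine ⟨x, hx, ?_⟩
  rw [mul_swap_apply_eq h, if_neg]
  · exact hx'
  · rintro (rfl | rfl)
    · exact hp (hU hx)
    · exact hp' (hU hx)

variable [Fintype S]

theorem card_support_mul_swap {τ : Equiv.Perm S} (h : ∀ x, τ (τ x) = x) {p : S} (hp : τ p ≠ p) :
    (τ * Equiv.swap p (τ p)).support.card + 2 = τ.support.card := by
  have h1 : (τ * Equiv.swap p (τ p)).support = τ.support \ {p, τ p} := by
    ext x
    simp only [Equiv.Perm.mem_support, mul_swap_apply_eq h, Finset.mem_sdiff, Finset.mem_insert,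
      Finset.mem_singleton]
    split_ifs with hx <;> simp [hx]
  have h2 : ({p, τ p} : Finset S) ⊆ τ.support := by
    intro x hx
    rw [Finset.mem_insert, Finset.mem_singleton] at hx
    rw [Equiv.Perm.mem_support]
    rcases hx with rfl | rfl
    · exact hp
    · rw [h]; exact hp.symm
  rw [h1, Finset.card_sdiff_of_subset h2, ← Finset.card_pair hp.symm]
  exact Nat.sub_add_cancel (Finset.card_le_card h2)

/-- `τ` is an involution moving at most `2 * #W` points, all of them in `Q` or in a fiber of `ν`
over `W`, and it leads out of the fiber over every nonempty subset of `W`. If `ν` does not send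
`Q` into `W`, then `τ` attaches the vertices in `W` to a root in a tree-like fashion, where `Q` is
the set of points of the root that may be used. -/
structure IsAttaching (ν : S → V) (W : Finset V) (Q : Finset S) (τ : Equiv.Perm S) : Prop where
  apply_apply : ∀ x, τ (τ x) = x
  moved : ∀ x, τ x ≠ x → x ∈ Q ∨ ν x ∈ W
  leaves : ∀ U ⊆ W, U.Nonempty → ∃ x, ν x ∈ U ∧ ν (τ x) ∉ U
  card_le : τ.support.card ≤ 2 * W.card

open Classical in
/-- The set of attaching involutions. -/
noncomputable def attachings (ν : S → V) (W : Finset V) (Q : Finset S) :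
    Finset (Equiv.Perm S) :=
  Finset.univ.filter (IsAttaching ν W Q)

theorem mem_attachings {ν : S → V} {W : Finset V} {Q : Finset S} {τ : Equiv.Perm S} :
    τ ∈ attachings ν W Q ↔ IsAttaching ν W Q τ := by
  simp [attachings]

variable [DecidableEq V]

/-- Some pair leads from a vertex of `W` out of `W`. Deleting this pair and this vertex preserves
the leaving property and costs two moved points, so induction applies. -/
theorem two_mul_card_le_card_support {ν : S → V} {W : Finset V} {τ : Equiv.Perm S}
    (h : ∀ x, τ (τ x) = x) (hl : ∀ U ⊆ W, U.Nonempty → ∃ x, ν x ∈ U ∧ ν (τ x) ∉ U) :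
    2 * W.card ≤ τ.support.card := by
  induction hw : W.card generalizing W τ with
  | zero => simp
  | succ w ih =>
    obtain ⟨x, hx, hx'⟩ := hl W subset_rfl (Finset.card_pos.1 (by omega))
    have hne : τ x ≠ x := fun h => hx' (by rwa [h])
    have := ih (mul_swap_involutive h x) (leaves_mul_swap h hl (Finset.erase_subset (ν x) W)
      (by simp) fun h => hx' (Finset.mem_of_mem_erase h))
      (by rw [Finset.card_erase_of_mem hx, hw]; rfl)
    have := card_support_mul_swap h hne
    omega

/-- A pair lying entirely outside `W` could be deleted without harming the leaving property, but `2
* #W` moved points are needed and no more are allowed: there are no wasted pairs. -/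
theorem IsAttaching.apply_not_mem {ν : S → V} {W : Finset V} {Q : Finset S} {τ : Equiv.Perm S}
    (h : IsAttaching ν W Q τ) {p : S} (hp : τ p ≠ p) (hpW : ν p ∉ W) : ν (τ p) ∈ W := by
  by_contra hW
  have h1 := two_mul_card_le_card_support (mul_swap_involutive h.apply_apply p)
    (leaves_mul_swap h.apply_apply h.leaves subset_rfl hpW hW)
  have h2 := card_support_mul_swap h.apply_apply hp
  have h3 := h.card_le
  omega

/-- The points that may be used at the root after the point `p` of the root has been joined to the
point `r`. -/
def attachedPoints (ν : S → V) (Q : Finset S) (p r : S) : Finset S :=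
  Q.erase p ∪ (Finset.univ.filter fun s => ν s = ν r).erase r

theorem IsAttaching.mul_swap {ν : S → V} {W : Finset V} {Q : Finset S} {τ : Equiv.Perm S}
    (h : IsAttaching ν W Q τ) {p : S} (hp : τ p ≠ p) (hpW : ν p ∉ W) :
    IsAttaching ν (W.erase (ν (τ p))) (attachedPoints ν Q p (τ p))
      (τ * Equiv.swap p (τ p)) := by
  have hW := h.apply_not_mem hp hpW
  refine ⟨mul_swap_involutive h.apply_apply p, fun x hx => ?_,
    leaves_mul_swap h.apply_apply h.leaves (Finset.erase_subset _ _)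
      (fun h => hpW (Finset.mem_of_mem_erase h)) (by simp), ?_⟩
  · rw [mul_swap_apply_eq h.apply_apply] at hx
    split_ifs at hx with hx'
    · exact absurd rfl hx
    · push Not at hx'
      simp only [attachedPoints, Finset.mem_union, Finset.mem_erase, Finset.mem_filter,
        Finset.mem_univ, true_and]
      rcases h.moved x hx with hQ | hQ
      · exact Or.inl (Or.inl ⟨hx'.1, hQ⟩)
      · by_cases hv : ν x = ν (τ p)
        · exact Or.inl (Or.inr ⟨hx'.2, hv⟩)
        · exact Or.inr ⟨hv, hQ⟩
  · have h2 := card_support_mul_swap h.apply_apply hp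
    have h3 := h.card_le
    rw [Finset.card_erase_of_mem hW]
    omega

/-- Case distinction on `p`: if it is fixed it can be dropped from `Q`; if it is joined to `r` over
`v`, then `v` is merged into the root, and multiplying by the swap again restores `τ`. -/
theorem attachings_subset {ν : S → V} {W : Finset V} {Q : Finset S} {p : S} (hp : ν p ∉ W) :
    attachings ν W Q ⊆ attachings ν W (Q.erase p) ∪
      W.biUnion fun v => (Finset.univ.filter fun r => ν r = v).biUnion fun r =>
        (attachings ν (W.erase v) (attachedPoints ν Q p r)).image (· * Equiv.swap p r) := by
  intro τ hτ
  rw [mem_attachings] at hτ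
  rw [Finset.mem_union]
  by_cases hp' : τ p = p
  · left
    rw [mem_attachings]
    refine ⟨hτ.apply_apply, fun x hx => ?_, hτ.leaves, hτ.card_le⟩
    refine (hτ.moved x hx).imp_left fun h => Finset.mem_erase.2 ⟨?_, h⟩
    rintro rfl
    exact hx hp'
  · right
    rw [Finset.mem_biUnion]
    refine ⟨ν (τ p), hτ.apply_not_mem hp' hp, ?_⟩
    rw [Finset.mem_biUnion]
    refine ⟨τ p, by simp, ?_⟩
    rw [Finset.mem_image]
    exact ⟨_, mem_attachings.2 (hτ.mul_swap hp' hp), by simp [mul_assoc]⟩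

/-- The number of ways to attach the vertices of `W` to a root with `a` points, if the vertex `v`
has `c v + 1` points. -/
def attachCount (c : V → ℕ) (W : Finset V) (a : ℕ) : ℕ :=
  if W = ∅ then 1
  else (∏ v ∈ W, (c v + 1)) * (a * (a - 1 + ∑ v ∈ W, c v).descFactorial (W.card - 1))

/-- The attaching recursion with the product of vertex sizes cancelled, for `#W = u + 2` and `c` the
sum of the `c v`; the coefficient `(u + 2) * a + c` is the sum of `a + c v` over `W`. With `m = a +
c - 1`, both sides are multiples of `m.descFactorial u`. -/
theorem mul_descFactorial_add (a c u : ℕ) :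
    a * (a - 1 + c).descFactorial (u + 1) + ((u + 2) * a + c) * (a + c - 1).descFactorial u =
      (a + 1) * (a + c).descFactorial (u + 1) := by
  rcases Nat.eq_zero_or_pos (a + c) with h | h
  · obtain ⟨rfl, rfl⟩ := Nat.add_eq_zero_iff.1 h
    simp
  · obtain ⟨m, hm⟩ := Nat.exists_eq_succ_of_ne_zero h.ne'
    have h1 : a * (a - 1 + c).descFactorial (u + 1) = a * m.descFactorial (u + 1) := by
      rcases Nat.eq_zero_or_pos a with rfl | ha
      · simp
      · rw [show a - 1 + c = m by omega]
    rw [h1, hm, Nat.succ_descFactorial_succ, Nat.descFactorial_succ, Nat.succ_sub_one]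
    rcases lt_or_ge m u with hu | hu
    · simp [Nat.descFactorial_of_lt hu]
    · obtain ⟨d, rfl⟩ := Nat.exists_eq_add_of_le hu
      obtain rfl | ⟨c', rfl⟩ : c = 0 ∨ ∃ c', c = c' + 1 := by cases c <;> simp
      · rw [Nat.add_sub_cancel_left, show a = u + d + 1 by omega]
        ring
      · have : u + d = a + c' := by omega
        have hd : (d : ℤ) = a + c' - u := by omega
        rw [Nat.add_sub_cancel_left]
        zify
        rw [hd]
        ring

theorem attachCount_succ (c : V → ℕ) {W : Finset V} (hW : W.Nonempty) (a : ℕ) :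
    attachCount c W a + ∑ v ∈ W, (c v + 1) * attachCount c (W.erase v) (a + c v) =
      attachCount c W (a + 1) := by
  have hW' := hW.ne_empty
  obtain ⟨w, hw⟩ := Nat.exists_eq_succ_of_ne_zero hW.card_pos.ne'
  rcases w with _ | u
  · obtain ⟨v, rfl⟩ := Finset.card_eq_one.1 hw
    simp [attachCount]
    ring
  · have h : ∀ v ∈ W, (c v + 1) * attachCount c (W.erase v) (a + c v) =
        (∏ v ∈ W, (c v + 1)) * ((a + c v) * (a + ∑ v ∈ W, c v - 1).descFactorial u) := by
      intro v hv
      have h1 : (W.erase v).card = u + 1 := by rw [Finset.card_erase_of_mem hv, hw]; rfl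
      have h2 : W.erase v ≠ ∅ := by
        rw [Ne, ← Finset.card_eq_zero, h1]
        exact Nat.succ_ne_zero u
      rw [attachCount, if_neg h2, h1, ← mul_assoc, Finset.mul_prod_erase W (fun v => c v + 1) hv]
      congr 1
      rcases Nat.eq_zero_or_pos (a + c v) with h | h
      · simp [h]
      · have := Finset.add_sum_erase W c hv
        congr 2
        omega
    rw [Finset.sum_congr rfl h, attachCount, attachCount, if_neg hW', if_neg hW', ← Finset.mul_sum,
      ← mul_add, ← Finset.sum_mul, Finset.sum_add_distrib, Finset.sum_const, hw, smul_eq_mul]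
    congr 1
    exact mul_descFactorial_add a _ u

theorem card_attachings_le (ν : S → V) (c : V → ℕ)
    (hc : ∀ v, (Finset.univ.filter fun s => ν s = v).card = c v + 1) (W : Finset V) (Q : Finset S)
    (hQ : ∀ x ∈ Q, ν x ∉ W) : (attachings ν W Q).card ≤ attachCount c W Q.card := by
  -- The measure is the number of points still available: discarding `p` lowers it by one, joining
  -- `p` to `r` by two.
  induction hN : Q.card + ∑ v ∈ W, (c v + 1) using Nat.strong_induction_on generalizing W Q with
  | _ N ih =>
    rcases W.eq_empty_or_nonempty with rfl | hW
    · rw [attachCount, if_pos rfl, Finset.card_le_one]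
      have h1 : ∀ τ ∈ attachings ν ∅ Q, τ = 1 := by
        intro τ hτ
        have := (mem_attachings.1 hτ).card_le
        simpa using this
      intro τ hτ τ' hτ'
      rw [h1 τ hτ, h1 τ' hτ']
    rcases Q.eq_empty_or_nonempty with rfl | ⟨p, hp⟩
    · have : attachings ν W ∅ = ∅ := by
        refine Finset.eq_empty_of_forall_notMem fun τ hτ => ?_
        have hτ := mem_attachings.1 hτ
        obtain ⟨x, hx, hx'⟩ := hτ.leaves W subset_rfl hW
        rcases hτ.moved (τ x) (fun h => hx' (by rwa [← h, hτ.apply_apply])) with h | h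
        · simp at h
        · exact hx' h
      simp [this]
    obtain ⟨a, ha⟩ := Nat.exists_eq_succ_of_ne_zero (Finset.card_pos.2 ⟨p, hp⟩).ne'
    have hpe : (Q.erase p).card = a := by rw [Finset.card_erase_of_mem hp, ha]; rfl
    have h1 : (attachings ν W (Q.erase p)).card ≤ attachCount c W a := by
      rw [← hpe]
      exact ih _ (by rw [hpe]; omega) W _ (fun x hx => hQ x (Finset.mem_of_mem_erase hx)) rfl
    have h2 : ∀ v ∈ W, ∀ r ∈ Finset.univ.filter (fun r => ν r = v),
        ((attachings ν (W.erase v) (attachedPoints ν Q p r)).image (· * Equiv.swap p r)).card ≤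
          attachCount c (W.erase v) (a + c v) := by
      intro v hv r hr
      have hr' : ν r = v := by simpa using hr
      have hcard : (attachedPoints ν Q p r).card = a + c v := by
        rw [attachedPoints, Finset.card_union_of_disjoint, hpe, hr', Finset.card_erase_of_mem hr, hc]
        · rfl
        · rw [Finset.disjoint_left]
          intro x hx hx'
          have h3 : ν x = ν r := by simpa using Finset.mem_of_mem_erase hx'
          exact hQ x (Finset.mem_of_mem_erase hx) (by rwa [h3, hr'])
      refine Finset.card_image_le.trans ?_
      rw [← hcard]
      refine ih _ ?_ _ _ ?_ rfl
      · have := Finset.add_sum_erase W (fun v => c v + 1) hv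
        rw [hcard]
        omega
      · intro x hx hxW
        rw [attachedPoints, Finset.mem_union] at hx
        rcases hx with hx | hx
        · exact hQ x (Finset.mem_of_mem_erase hx) (Finset.mem_of_mem_erase hxW)
        · have h3 : ν x = ν r := by simpa using Finset.mem_of_mem_erase hx
          rw [h3, hr'] at hxW
          simp at hxW
    calc (attachings ν W Q).card
        ≤ _ := Finset.card_le_card (attachings_subset (hQ p hp))
      _ ≤ attachCount c W a + ∑ v ∈ W, (c v + 1) * attachCount c (W.erase v) (a + c v) := by
        refine (Finset.card_union_le _ _).trans (add_le_add h1 ?_)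
        refine Finset.card_biUnion_le.trans (Finset.sum_le_sum fun v hv => ?_)
        refine Finset.card_biUnion_le.trans ((Finset.sum_le_sum (h2 v hv)).trans ?_)
        rw [Finset.sum_const, hc, smul_eq_mul]
      _ = attachCount c W Q.card := by rw [attachCount_succ c hW, ha]

end Counting

/-! ### From splicing involutions of trees to attaching involutions. -/

section Splice

theorem prod_swap_apply {α : Type*} [DecidableEq α] {m : ℕ} (i j : Fin m → α)
    (h : Function.Injective (Sum.elim i j)) :
    (∀ l, (List.ofFn fun l => Equiv.swap (i l) (j l)).prod (i l) = j l) ∧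
    (∀ l, (List.ofFn fun l => Equiv.swap (i l) (j l)).prod (j l) = i l) ∧
    ∀ x, (∀ l, x ≠ i l ∧ x ≠ j l) → (List.ofFn fun l => Equiv.swap (i l) (j l)).prod x = x := by
  induction m with
  | zero => simp
  | succ m ih =>
    have hii : ∀ a b, i a = i b → a = b := fun a b hab => by
      simpa using @h (Sum.inl a) (Sum.inl b) hab
    have hjj : ∀ a b, j a = j b → a = b := fun a b hab => by
      simpa using @h (Sum.inr a) (Sum.inr b) hab
    have hij : ∀ a b, i a ≠ j b := fun a b hab => by
      simpa using @h (Sum.inl a) (Sum.inr b) hab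
    obtain ⟨h1, h2, h3⟩ := ih (fun l => i l.succ) (fun l => j l.succ) (by
      rintro (a | a) (b | b) hab
      · simpa using hii _ _ hab
      · exact absurd hab (hij _ _)
      · exact absurd hab.symm (hij _ _)
      · simpa using hjj _ _ hab)
    simp only [List.ofFn_succ, List.prod_cons, Equiv.Perm.mul_apply]
    refine ⟨fun l => ?_, fun l => ?_, fun x hx => ?_⟩
    · cases l using Fin.cases with
      | zero =>
        rw [h3 _ fun l => ⟨fun e => Fin.succ_ne_zero l (hii _ _ e).symm, hij _ _⟩,
          Equiv.swap_apply_left]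
      | succ l =>
        rw [h1, Equiv.swap_apply_of_ne_of_ne (hij _ _).symm fun e => Fin.succ_ne_zero l (hjj _ _ e)]
    · cases l using Fin.cases with
      | zero =>
        rw [h3 _ fun l => ⟨(hij _ _).symm, fun e => Fin.succ_ne_zero l (hjj _ _ e).symm⟩,
          Equiv.swap_apply_right]
      | succ l =>
        rw [h2, Equiv.swap_apply_of_ne_of_ne (fun e => Fin.succ_ne_zero l (hii _ _ e)) (hij _ _)]
    · rw [h3 x fun l => hx l.succ, Equiv.swap_apply_of_ne_of_ne (hx 0).1 (hx 0).2]

variable {n k : ℕ} {T : SimpleGraph (Fin k)} {ν : Fin n → Fin k} {τ : Equiv.Perm (Fin n)}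

theorem IsSplice.card_support (h : IsSplice T ν τ) : τ.support.card = 2 * (k - 1) := by
  obtain ⟨-, i, j, hinj, rfl, -⟩ := h
  obtain ⟨h1, h2, h3⟩ := prod_swap_apply i j hinj
  have : (List.ofFn fun l => Equiv.swap (i l) (j l)).prod.support =
      Finset.univ.image (Sum.elim i j) := by
    ext x
    simp only [Equiv.Perm.mem_support, Finset.mem_image, Finset.mem_univ, true_and, Sum.exists,
      Sum.elim_inl, Sum.elim_inr]
    have hij : ∀ a b, i a ≠ j b := fun a b hab => by
      simpa using @hinj (Sum.inl a) (Sum.inr b) hab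
    constructor
    · intro hx
      by_contra hx'
      push Not at hx'
      exact hx (h3 x fun l => ⟨(hx'.1 l).symm, (hx'.2 l).symm⟩)
    · rintro (⟨l, rfl⟩ | ⟨l, rfl⟩)
      · rw [h1]; exact (hij _ _).symm
      · rw [h2]; exact hij _ _
  rw [this, Finset.card_image_of_injective _ hinj, Finset.card_univ, Fintype.card_sum,
    Fintype.card_fin, two_mul]

theorem IsSplice.apply_apply (h : IsSplice T ν τ) (x : Fin n) : τ (τ x) = x := by
  have := h.1
  rw [sq] at this
  exact DFunLike.congr_fun this x

/-- Reads the edges off `τ` alone, independently of the chosen factorization; hence `τ` determines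
the tree. -/
theorem IsSplice.mem_edgeSet_iff (h : IsSplice T ν τ) (e : Sym2 (Fin k)) :
    e ∈ T.edgeSet ↔ ∃ x, τ x ≠ x ∧ s(ν x, ν (τ x)) = e := by
  obtain ⟨-, i, j, hinj, rfl, hT⟩ := h
  obtain ⟨h1, h2, h3⟩ := prod_swap_apply i j hinj
  have hij : ∀ a b, i a ≠ j b := fun a b hab => by
    simpa using @hinj (Sum.inl a) (Sum.inr b) hab
  rw [hT]
  constructor
  · rintro ⟨l, rfl⟩
    exact ⟨i l, by rw [h1]; exact (hij _ _).symm, by rw [h1]⟩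
  · rintro ⟨x, hx, rfl⟩
    by_cases hx' : ∀ l, x ≠ i l ∧ x ≠ j l
    · exact absurd (h3 x hx') hx
    · push Not at hx'
      obtain ⟨l, hl⟩ := hx'
      by_cases hxi : x = i l
      · rw [hxi, h1]
        exact ⟨l, rfl⟩
      · rw [hl hxi, h2]
        exact ⟨l, Sym2.eq_swap⟩

theorem IsSplice.graph_unique {T' : SimpleGraph (Fin k)} (h : IsSplice T ν τ)
    (h' : IsSplice T' ν τ) : T = T' := by
  rw [← SimpleGraph.edgeSet_inj]
  ext e
  rw [h.mem_edgeSet_iff, h'.mem_edgeSet_iff]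

theorem IsSplice.isAttaching (h : IsSplice T ν τ) (hT : T.IsTree) (ρ : Fin k) :
    IsAttaching ν (Finset.univ.erase ρ) (Finset.univ.filter fun s => ν s = ρ) τ := by
  refine ⟨h.apply_apply, fun x _ => ?_, fun U hU ⟨u, hu⟩ => ?_, ?_⟩
  · simpa using em (ν x = ρ)
  · have hρ : ρ ∉ U := fun hρ => by simpa using hU hρ
    obtain ⟨p⟩ := hT.connected.preconnected u ρ
    -- By connectedness a walk from `U` to the root must cross the boundary of `U`, and the crossing
    -- edge comes from a pair of `τ`.
    obtain ⟨d, -, hd1, hd2⟩ := p.exists_boundary_dart (U : Set (Fin k)) hu hρ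
    obtain ⟨x, -, hx⟩ := (h.mem_edgeSet_iff s(d.fst, d.snd)).1 d.adj
    rcases Sym2.eq_iff.1 hx with ⟨e1, e2⟩ | ⟨e1, e2⟩
    · exact ⟨x, by rw [e1]; exact hd1, by rw [e2]; exact hd2⟩
    · exact ⟨τ x, by rw [e2]; exact hd1, by rw [h.apply_apply, e1]; exact hd2⟩
  · rw [h.card_support, Finset.card_erase_of_mem (Finset.mem_univ _), Finset.card_univ,
      Fintype.card_fin]

theorem two_mul_le_of_isSplice (h : IsSplice T ν τ) : 2 * (k - 1) ≤ n := by
  rw [← h.card_support]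
  exact (Finset.card_le_univ _).trans (Fintype.card_fin n).le

theorem mem_coloredSplice {γ : Fin n → Fin n} :
    τ ∈ coloredSplice T ν γ ↔ IsSplice T ν τ ∧ γ ∘ τ = γ := by
  simp [coloredSplice]

open Classical in
/-- The number of splicing involutions, for all trees together. -/
theorem sum_card_coloredSplice_le (hν : Function.Surjective ν) (hk : 0 < k) (hkn : 2 * k ≤ n + 2)
    (γ : Fin n → Fin n) :
    (∑ T : SimpleGraph (Fin k) with T.IsTree, (coloredSplice T ν γ).card) *
        (n + 2 - 2 * k).factorial ≤
      (n - k).factorial * ∏ i : Fin k, Nat.card {s : Fin n // ν s = i} := by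
  set N : Fin k → ℕ := fun i => (Finset.univ.filter fun s => ν s = i).card with hN
  have hcard : ∀ i, Nat.card {s : Fin n // ν s = i} = N i := fun i => by
    rw [Nat.card_eq_fintype_card, Fintype.card_subtype]
  have hpos : ∀ i, 0 < N i := fun i => by
    obtain ⟨s, hs⟩ := hν i
    exact Finset.card_pos.2 ⟨s, by simp [hs]⟩
  have hsum : ∑ i, N i = n := by
    rw [← Finset.card_eq_sum_card_fiberwise (f := ν) (t := Finset.univ) (by simp),
      Finset.card_univ, Fintype.card_fin]
  let ρ : Fin k := ⟨0, hk⟩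
  have h1 : ∑ T : SimpleGraph (Fin k) with T.IsTree, (coloredSplice T ν γ).card ≤
      (attachings ν (Finset.univ.erase ρ) (Finset.univ.filter fun s => ν s = ρ)).card := by
    rw [← Finset.card_biUnion]
    · refine Finset.card_le_card fun τ hτ => ?_
      rw [Finset.mem_biUnion] at hτ
      obtain ⟨T, hT, hτ⟩ := hτ
      rw [mem_attachings]
      exact (mem_coloredSplice.1 hτ).1.isAttaching (Finset.mem_filter.1 hT).2 ρ
    · intro T _ T' _ hne
      refine Finset.disjoint_left.2 fun τ hτ hτ' => hne ?_
      exact (mem_coloredSplice.1 hτ).1.graph_unique (mem_coloredSplice.1 hτ').1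
  have h2 := card_attachings_le ν (fun i => N i - 1) (fun v => (Nat.sub_add_cancel (hpos v)).symm)
    (Finset.univ.erase ρ) (Finset.univ.filter fun s => ν s = ρ) (by simp)
  refine (Nat.mul_le_mul_right _ (h1.trans h2)).trans ?_
  simp only [hcard, attachCount, Nat.sub_add_cancel (hpos _)]
  have hcardW : (Finset.univ.erase ρ).card = k - 1 := by
    rw [Finset.card_erase_of_mem (Finset.mem_univ _), Finset.card_univ, Fintype.card_fin]
  have hprod : (∏ v ∈ Finset.univ.erase ρ, N v) * N ρ = ∏ v, N v :=
    Finset.prod_erase_mul _ _ (Finset.mem_univ _)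
  -- For `k = 1` there is nothing to attach and the claim is `n! = (n - 1)! * n`; otherwise the
  -- falling factorial has `k - 2` factors starting from `n - k`.
  split_ifs with hW
  · have hk1 : k = 1 := by
      rw [hW, Finset.card_empty] at hcardW
      omega
    subst hk1
    have hn : ∏ i, N i = n := by
      rw [← hsum]
      simp
    obtain ⟨m, rfl⟩ : ∃ m, n = m + 1 := 
      Nat.exists_eq_succ_of_ne_zero (Fin.pos (hν ρ).choose).ne'
    rw [hn]
    simp [Nat.factorial_succ, mul_comm]
  · have hs : N ρ - 1 + ∑ v ∈ Finset.univ.erase ρ, (N v - 1) = n - k := by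
      rw [Finset.add_sum_erase _ (fun v => N v - 1) (Finset.mem_univ _)]
      have : ∑ v, (N v - 1) + ∑ v : Fin k, 1 = ∑ v, N v := by
        rw [← Finset.sum_add_distrib]
        exact Finset.sum_congr rfl fun v _ => Nat.sub_add_cancel (hpos v)
      simp only [Finset.sum_const, Finset.card_univ, Fintype.card_fin, smul_eq_mul, mul_one,
        hsum] at this
      omega
    have hk2 : k - 1 ≠ 0 := by
      rwa [← hcardW, Ne, Finset.card_eq_zero]
    have hf := Nat.factorial_mul_descFactorial (n := n - k) (k := k - 1 - 1) (by omega)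
    rw [show n - k - (k - 1 - 1) = n + 2 - 2 * k by omega] at hf
    rw [hcardW]
    change (∏ v ∈ Finset.univ.erase ρ, N v) * (N ρ *
      (N ρ - 1 + ∑ v ∈ Finset.univ.erase ρ, (N v - 1)).descFactorial _) * _ ≤ _
    rw [hs, ← hf, ← hprod]
    apply le_of_eq
    ring

end Splice

/-! ### Evaluation of polynomials with random coefficients -/

section Expectation

open MeasureTheory

variable {Ω X : Type*}

/-- The coefficient of a word in a noncommutative polynomial. -/
noncomputable def wordCoeff {R : Type*} [CommSemiring R] (P : FreeAlgebra R X) (w : FreeMonoid X) :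
    R :=
  (FreeAlgebra.equivMonoidAlgebraFreeMonoid P).coeff w

theorem lift_eq_sum_wordCoeff {A : Type*} [Semiring A] [Algebra ℂ A] (z : X → A)
    (P : FreeAlgebra ℂ X) {s : Finset (FreeMonoid X)} (hs : ∀ w ∉ s, wordCoeff P w = 0) :
    FreeAlgebra.lift ℂ z P = ∑ w ∈ s, wordCoeff P w • FreeMonoid.lift z w := by
  have h : FreeAlgebra.lift ℂ z = (MonoidAlgebra.lift ℂ A (FreeMonoid X) (FreeMonoid.lift z)).comp
      (FreeAlgebra.equivMonoidAlgebraFreeMonoid (R := ℂ) (X := X)).toAlgHom := by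
    ext x
    simp [FreeAlgebra.equivMonoidAlgebraFreeMonoid]
  rw [h, AlgHom.comp_apply, MonoidAlgebra.lift_apply, Finsupp.sum_of_support_subset (s := s)]
  · rfl
  · intro w hw
    by_contra hws
    exact Finsupp.mem_support_iff.1 hw (hs w hws)
  · simp

/-- The value of a polynomial with random coefficients at the sample point `ω`. -/
noncomputable def sampleAt (X : Type*) (ω : Ω) :
    FreeAlgebra (Ω → ℂ) X →ₐ[ℂ] FreeAlgebra ℂ X :=
  (FreeAlgebra.equivMonoidAlgebraFreeMonoid (R := ℂ) (X := X)).symm.toAlgHom.comp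
    ((MonoidAlgebra.mapAlgHom (FreeMonoid X) (Pi.evalAlgHom ℂ (fun _ : Ω => ℂ) ω)).comp
      ((FreeAlgebra.equivMonoidAlgebraFreeMonoid (R := Ω → ℂ) (X := X)).toAlgHom.restrictScalars ℂ))

theorem wordCoeff_sampleAt (ω : Ω) (P : FreeAlgebra (Ω → ℂ) X) (w : FreeMonoid X) :
    wordCoeff (sampleAt X ω P) w = wordCoeff P w ω := by
  simp [wordCoeff, sampleAt]

theorem sampleAt_smul_ι (ω : Ω) (f : Ω → ℂ) (x : X) :
    sampleAt X ω (f • FreeAlgebra.ι (Ω → ℂ) x) = f ω • FreeAlgebra.ι ℂ x := by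
  apply (FreeAlgebra.equivMonoidAlgebraFreeMonoid (R := ℂ) (X := X)).injective
  simp [sampleAt, FreeAlgebra.equivMonoidAlgebraFreeMonoid]

variable [MeasurableSpace Ω]

/-- The algebra of bounded, almost everywhere measurable functions. -/
def boundedMeasurable (μ : Measure Ω) : Subalgebra ℂ (Ω → ℂ) where
  carrier := {f | AEStronglyMeasurable f μ ∧ ∃ C, ∀ ω, ‖f ω‖ ≤ C}
  mul_mem' := by
    rintro f g ⟨hf, C, hC⟩ ⟨hg, D, hD⟩
    refine ⟨hf.mul hg, C * D, fun ω => ?_⟩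
    rw [Pi.mul_apply, norm_mul]
    exact mul_le_mul (hC ω) (hD ω) (norm_nonneg _) ((norm_nonneg _).trans (hC ω))
  add_mem' := by
    rintro f g ⟨hf, C, hC⟩ ⟨hg, D, hD⟩
    exact ⟨hf.add hg, C + D, fun ω => (norm_add_le _ _).trans (add_le_add (hC ω) (hD ω))⟩
  algebraMap_mem' r := ⟨aestronglyMeasurable_const, ‖r‖, fun _ => le_rfl⟩

/-- The polynomials whose coefficients are bounded and measurable. -/
def boundedPoly (X : Type*) (μ : Measure Ω) : Subalgebra ℂ (FreeAlgebra (Ω → ℂ) X) where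
  carrier := {P | ∀ w, wordCoeff P w ∈ boundedMeasurable μ}
  mul_mem' := by
    classical
    intro P Q hP hQ w
    rw [wordCoeff, map_mul, MonoidAlgebra.coeff_mul]
    refine Subalgebra.sum_mem _ fun a _ => Subalgebra.sum_mem _ fun b _ => ?_
    dsimp only
    split_ifs
    · exact Subalgebra.mul_mem _ (hP a) (hQ b)
    · exact Subalgebra.zero_mem _
  add_mem' := by
    intro P Q hP hQ w
    rw [wordCoeff, map_add]
    exact Subalgebra.add_mem _ (hP w) (hQ w)
  algebraMap_mem' r w := by
    classical
    rw [wordCoeff, IsScalarTower.algebraMap_apply ℂ (Ω → ℂ), AlgEquiv.commutes,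
      MonoidAlgebra.coe_algebraMap, Function.comp_apply, MonoidAlgebra.coeff_single, Finsupp.single_apply]
    split_ifs
    · exact Subalgebra.algebraMap_mem _ r
    · exact Subalgebra.zero_mem _

theorem smul_ι_mem_boundedPoly {μ : Measure Ω} {f : Ω → ℂ} (hf : f ∈ boundedMeasurable μ) (x : X) :
    f • FreeAlgebra.ι (Ω → ℂ) x ∈ boundedPoly X μ := by
  classical
  intro w
  have : wordCoeff (f • FreeAlgebra.ι (Ω → ℂ) x) w = if FreeMonoid.of x = w then f else 0 := by
    simp [wordCoeff, FreeAlgebra.equivMonoidAlgebraFreeMonoid, Finsupp.single_apply]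
  rw [this]
  split_ifs
  · exact hf
  · exact Subalgebra.zero_mem _

theorem lift_mem_of_forall_mem {R B Y : Type*} [CommSemiring R] [Semiring B] [Algebra R B]
    {C : Subalgebra R B} {f : Y → B} (hf : ∀ y, f y ∈ C) (P : FreeAlgebra R Y) :
    FreeAlgebra.lift R f P ∈ C := by
  induction P using FreeAlgebra.induction with
  | grade0 r => rw [AlgHom.commutes]; exact C.algebraMap_mem r
  | grade1 y => rw [FreeAlgebra.lift_ι_apply]; exact hf y
  | mul a b ha hb => rw [map_mul]; exact C.mul_mem ha hb
  | add a b ha hb => rw [map_add]; exact C.add_mem ha hb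

/-- Evaluation is a finite linear combination of the coefficients, so it commutes with the integral;
boundedness and measurability of the coefficients make each term integrable. The norm of a mean is
at most the uniform bound. -/
theorem norm_lift_termwiseExpectation_le {A : Type*} [CStarAlgebra A] (z : X → A) (μ : Measure Ω)
    [IsProbabilityMeasure μ] {P : FreeAlgebra (Ω → ℂ) X} (hP : P ∈ boundedPoly X μ) {C : ℝ}
    (hC : ∀ ω, ‖FreeAlgebra.lift ℂ z (sampleAt X ω P)‖ ≤ C) :
    ‖FreeAlgebra.lift ℂ z (termwiseExpectation μ P)‖ ≤ C := by
  set s := (FreeAlgebra.equivMonoidAlgebraFreeMonoid P).coeff.support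
  have hs : ∀ w ∉ s, wordCoeff P w = 0 := fun w hw => Finsupp.notMem_support_iff.1 hw
  have hE : ∀ w, wordCoeff (termwiseExpectation μ P) w = ∫ ω, wordCoeff P w ω ∂μ := by
    intro w
    simp [wordCoeff, termwiseExpectation]
  have h : FreeAlgebra.lift ℂ z (termwiseExpectation μ P) =
      ∫ ω, FreeAlgebra.lift ℂ z (sampleAt X ω P) ∂μ := by
    have h1 : ∀ ω, FreeAlgebra.lift ℂ z (sampleAt X ω P) =
        ∑ w ∈ s, wordCoeff P w ω • FreeMonoid.lift z w := fun ω => by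
      rw [lift_eq_sum_wordCoeff z _ (s := s) fun w hw => by rw [wordCoeff_sampleAt, hs w hw]; rfl]
      simp only [wordCoeff_sampleAt]
    simp only [h1]
    rw [lift_eq_sum_wordCoeff z _ (s := s) fun w hw => by rw [hE, hs w hw]; simp,
      integral_finsetSum]
    · exact Finset.sum_congr rfl fun w _ => by rw [hE, integral_smul_const]
    · intro w _
      obtain ⟨hm, D, hD⟩ := hP w
      exact (Integrable.of_bound hm D (Filter.Eventually.of_forall hD)).smul_const _
  rw [h]
  simpa using norm_integral_le_of_norm_le_const (Filter.Eventually.of_forall hC) (μ := μ)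

end Expectation

/-! ### The norm of the arboreal polynomial -/

section Norm

variable {n k : ℕ}

theorem randomVariable_mem_boundedPoly {T : SimpleGraph (Fin k)} (hT : T.IsTree) (i : Fin k)
    (j : Fin n) : randomVariable T i j ∈ boundedPoly (Fin k × Fin n) (edgeLaw T) := by
  refine Subalgebra.sum_mem _ fun i' _ => smul_ι_mem_boundedPoly ⟨?_, 1, fun x => ?_⟩ _
  · exact (Complex.measurable_ofReal.comp_aemeasurable
      (aemeasurable_sqrtWeight hT i i')).aestronglyMeasurable
  · rw [Complex.norm_real]
    exact abs_sqrtWeight_le_one T x i i'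

theorem sampleAt_randomVariable (T : SimpleGraph (Fin k)) (x : T.edgeSet → ℝ) (i : Fin k)
    (j : Fin n) : sampleAt (Fin k × Fin n) x (randomVariable T i j) =
      ∑ i', (sqrtWeight T x i i' : ℂ) • FreeAlgebra.ι ℂ (i', j) := by
  simp only [randomVariable, map_sum, sampleAt_smul_ι]

theorem card_cycleNotations_le_one [NeZero n] (σ : Equiv.Perm (Fin n)) :
    (cycleNotations σ).card ≤ 1 := by
  classical
  rw [Finset.card_le_one]
  intro i hi i' hi'
  simp only [cycleNotations, Finset.mem_filter, Finset.mem_univ, true_and] at hi hi'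
  obtain ⟨m, rfl⟩ := Nat.exists_eq_succ_of_ne_zero (NeZero.ne n)
  ext a
  congr 1
  induction a using Fin.induction with
  | zero => exact hi.2.2.trans hi'.2.2.symm
  | succ a ih =>
    rw [← Fin.coeSucc_eq_succ, ← hi.2.1, ← hi'.2.1, ih]

theorem norm_lift_splicingPoly_le {A : Type*} [NormedRing A] [NormOneClass A] [NormedAlgebra ℂ A]
    [NeZero n] (θ : Equiv.Perm (Fin n)) (γ : Fin n → Fin n) (ν : Fin n → Fin k)
    (T : SimpleGraph (Fin k)) {y : Fin n → A} {C : ℝ} (hC : 0 ≤ C) (hy : ∀ s, ‖y s‖ ≤ C) :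
    ‖FreeAlgebra.lift ℂ y (splicingPoly θ γ ν T)‖ ≤
      (coloredSplice T ν γ).card * C ^ (n - 2 * (k - 1)) := by
  classical
  rw [splicingPoly, map_sum, ← nsmul_eq_mul]
  refine (norm_sum_le _ _).trans (Finset.sum_le_card_nsmul _ _ _ fun τ hτ => ?_)
  have hτ := (mem_coloredSplice.1 hτ).1
  rw [map_sum]
  refine (norm_sum_le _ _).trans
    ((Finset.sum_le_card_nsmul _ _ (C ^ (n - 2 * (k - 1))) fun i hi => ?_).trans ?_)
  · have hi : Function.Injective i := (Finset.mem_filter.1 hi).2.1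
    have hbij : Function.Bijective i := Finite.injective_iff_bijective.1 hi
    -- Only fixed points of `τ` carry exponent 1; the other factors are `1`.
    have hcard : (Finset.univ.filter fun a => i a = τ (i a)).card = n - 2 * (k - 1) := by
      rw [← hτ.card_support, ← Finset.card_image_of_injective _ hi]
      have : (Finset.univ.filter fun a => i a = τ (i a)).image i = τ.supportᶜ := by
        ext s
        obtain ⟨a, rfl⟩ := hbij.2 s
        simp [hi.eq_iff, eq_comm]
      rw [this, Finset.card_compl, Fintype.card_fin]
    rw [map_list_prod, List.map_ofFn]
    refine (List.norm_prod_le _).trans ?_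
    rw [List.map_ofFn, List.prod_ofFn, ← hcard, ← Finset.prod_const, Finset.prod_filter]
    refine Finset.prod_le_prod (fun _ _ => norm_nonneg _) fun a _ => ?_
    simp only [Function.comp]
    split_ifs
    · simpa using hy (i a)
    · simp
  · rw [nsmul_eq_mul]
    exact mul_le_of_le_one_left (by positivity) (by exact_mod_cast card_cycleNotations_le_one _)

open Classical in
theorem norm_lift_arb_le [NeZero n] (θ : Equiv.Perm (Fin n)) (γ : Fin n → Fin n)
    (ν : Fin n → Fin k) {A : Type*} [CStarAlgebra A] {φ : A →ₗ[ℂ] ℂ}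
    (hφ : IsFaithfulTracialState φ) (z : Fin k × Fin n → A) (hz : IsFreeSemicircularFamily φ z) :
    ‖FreeAlgebra.lift ℂ z (arb θ γ ν)‖ ≤
      (∑ T : SimpleGraph (Fin k) with T.IsTree, (coloredSplice T ν γ).card : ℕ) *
        2 ^ (n - 2 * (k - 1)) := by
  have : Nontrivial A := by
    refine ⟨⟨1, 0, fun h => ?_⟩⟩
    have h1 := hφ.map_one
    rw [h, map_zero] at h1
    exact zero_ne_one h1
  rw [arb, map_sum, Nat.cast_sum, Finset.sum_mul]
  refine norm_sum_le_of_le _ fun T hT => ?_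
  have hT : T.IsTree := (Finset.mem_filter.1 hT).2
  refine norm_lift_termwiseExpectation_le z (edgeLaw T)
    (lift_mem_of_forall_mem (fun s => randomVariable_mem_boundedPoly hT (ν s) (γ s)) _) fun x => ?_
  have h : (FreeAlgebra.lift ℂ z).comp ((sampleAt (Fin k × Fin n) x).comp
      (FreeAlgebra.lift ℂ fun s => randomVariable T (ν s) (γ s))) =
      FreeAlgebra.lift ℂ fun s => ∑ i', (sqrtWeight T x (ν s) i' : ℂ) • z (i', γ s) := by
    ext s
    simp only [Function.comp_apply, AlgHom.comp_apply, FreeAlgebra.lift_ι_apply,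
      sampleAt_randomVariable, map_sum, map_smul]
  have h' := DFunLike.congr_fun h (splicingPoly θ γ ν T)
  simp only [AlgHom.comp_apply] at h'
  rw [h']
  refine norm_lift_splicingPoly_le θ γ ν T zero_le_two fun s => ?_
  -- A row of the square root is extended by zero to all `(i', j)` with `j ≠ γ s`, which keeps it a
  -- unit vector.
  have h1 := hz.norm_sum_smul_le hφ
    (fun p => if p.2 = γ s then sqrtWeight T x (ν s) p.1 else 0) (by
      simp [Fintype.sum_prod_type, ite_pow, sum_sqrtWeight_sq])
  simpa [Fintype.sum_prod_type, apply_ite, ite_smul] using h1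

end Norm

end PlanarMaps

theorem mainTheorem5 {n k : ℕ} [NeZero n] (θ : Equiv.Perm (Fin n)) (γ : Fin n → Fin n)
    (hk : k = PlanarMaps.numCycles θ)
    (ν : Fin n → Fin k) (hν_onto : Function.Surjective ν) (hν_inv : ∀ s, ν (θ s) = ν s)
    {A : Type*} [CStarAlgebra A] (φ : A →ₗ[ℂ] ℂ) (hφ : PlanarMaps.IsFaithfulTracialState φ)
    (z : Fin k → Fin n → A)
    (hz : PlanarMaps.IsFreeSemicircularFamily φ (fun p : Fin k × Fin n => z p.1 p.2)) :
    ‖FreeAlgebra.lift ℂ (fun p : Fin k × Fin n => z p.1 p.2) (PlanarMaps.arb θ γ ν)‖ ≤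
      if 2 * k ≤ n + 2 then
        2 ^ (n + 2 - 2 * k) *
          (((n - k).factorial : ℝ) * ∏ i : Fin k, (Nat.card {s : Fin n // ν s = i} : ℝ)) /
            ((n + 2 - 2 * k).factorial : ℝ)
      else 0 := by
  have hk0 : 0 < k := Fin.pos (ν 0)
  refine (PlanarMaps.norm_lift_arb_le θ γ ν hφ _ hz).trans ?_
  split_ifs with hkn
  · have h := PlanarMaps.sum_card_coloredSplice_le hν_onto hk0 hkn γ
    rw [← mul_div_assoc', mul_comm, show n - 2 * (k - 1) = n + 2 - 2 * k by omega]
    refine mul_le_mul_of_nonneg_left ?_ (by positivity)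
    rw [le_div_iff₀ (by positivity)]
    exact_mod_cast h
  -- With fewer than `2(k - 1)` points there is no room for `k - 1` disjoint transpositions.
  · rw [Finset.sum_eq_zero, Nat.cast_zero, zero_mul]
    intro T _
    rw [Finset.card_eq_zero]
    refine Finset.eq_empty_of_forall_notMem fun τ hτ => ?_
    have := PlanarMaps.two_mul_le_of_isSplice (PlanarMaps.mem_coloredSplice.1 hτ).1
    omega
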